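/- Let $S$ be a real symmetric $n\times n$ matrix with simple spectrum $\lambda_1>\dots>\lambda_n$ and put $\Lambda=\mathrm{diag}(\lambda_1,\dots,\lambda_n)$. Let $$\mathcal F_S=\{Q^TSQ : Q\in SO(n,\mathbb R)\}\cap\{RSR^{-1} : R\in Up^+(n,\mathbb R)\}$$ be the slice through $S$, where $Up^+(n,\mathbb R)$ is the group of real upper triangular matrices with positive diagonal entries, and let $\overline{\mathcal F_S}$ be its closure in the space of real $n\times n$ matrices. Then every $S'\in\overline{\mathcal F_S}$ can be written $S'=Q'^T\Lambda Q'$ with $Q'\in SO(n,\mathbb R)$, and the BFR map $F(S')=\mathrm{diag}(Q'\Lambda Q'^T)\in\mathbb R^n$ is independent of the choice of $Q'$. Let the spectral polytope $\mathcal P_S$ be the convex hull of the points $F(D)$, where $D$ runs over the diagonal matrices in $\overline{\mathcal F_S}$. The restriction of $F$ to $\overline{\mathcal F_S}$ is a homeomorphism onto $\mathcal P_S$, and it restricts to a ($C^\infty$) diffeomorphism from $\mathcal F_S$ (the interior of $\overline{\mathcal F_S}$, i.e. the complement of its boundary $\overline{\mathcal F_S}\setminus\mathcal F_S$) onto the interior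 of $\mathcal P_S$ relative to its affine span. (A map between subsets of Euclidean spaces is called smooth if near each point it extends to a smooth map on an open set of the ambient space.) If moreover $S$ is irreducible, i.e. leaves invariant no subspace spanned by a nonempty proper subset of the canonical basis, then the affine span of $\mathcal P_S$ is the hyperplane $\{x\in\mathbb R^n : \sum_i x_i=\sum_i\lambda_i\}$, so that the relative interior above is the interior of $\mathcal P_S$ in this hyperplane. -/

import Mathlib

open scoped Matrix ContDiff

attribute [local instance] Matrix.normedAddCommGroup Matrix.normedSpace

noncomputable section

/-- Upper triangular matrices with positive diagonal entries. -/
def UpPos (n : ℕ) : Set (Matrix (Fin n) (Fin n) ℝ) :=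
  {R | R.BlockTriangular id ∧ ∀ i, 0 < R i i}

/-- The slice through `S`: the intersection of the conjugation orbits of `S` under the special
orthogonal group and under the upper triangular matrices with positive diagonal. -/
def slice {n : ℕ} (S : Matrix (Fin n) (Fin n) ℝ) : Set (Matrix (Fin n) (Fin n) ℝ) :=
  {T | ∃ Q ∈ Matrix.specialOrthogonalGroup (Fin n) ℝ, T = Qᵀ * S * Q} ∩
    {T | ∃ R ∈ UpPos n, T = R * S * R⁻¹}

/-- The symmetric matrices `Qᵀ Λ Q`, `Q ∈ SO(n)`, where `Λ = diag(lam)`. -/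
def isospectral {n : ℕ} (lam : Fin n → ℝ) : Set (Matrix (Fin n) (Fin n) ℝ) :=
  {T | ∃ Q ∈ Matrix.specialOrthogonalGroup (Fin n) ℝ, T = Qᵀ * Matrix.diagonal lam * Q}

open Classical in
/-- The BFR map: `Qᵀ Λ Q ↦ diag(Q Λ Qᵀ)` on the isospectral set of `Λ = diag(lam)`. It does not
depend on the choice of `Q` when the entries of `lam` are distinct (`bfr_eq`). Outside of the
isospectral set the value is irrelevant and is set to `0`. -/
def bfr {n : ℕ} (lam : Fin n → ℝ) (T : Matrix (Fin n) (Fin n) ℝ) : Fin n → ℝ :=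
  if h : T ∈ isospectral lam then
    (h.choose * Matrix.diagonal lam * (h.choose)ᵀ).diag
  else 0

theorem diag_conj_apply {n : ℕ} (lam : Fin n → ℝ) (Q : Matrix (Fin n) (Fin n) ℝ) (i : Fin n) :
    (Q * Matrix.diagonal lam * Qᵀ).diag i = ∑ j, lam j * (Q i j) ^ 2 := by
  rw [Matrix.diag_apply, Matrix.mul_apply]
  refine Finset.sum_congr rfl fun j _ => ?_
  rw [Matrix.mul_diagonal, Matrix.transpose_apply]
  ring

theorem bfr_eq {n : ℕ} {lam : Fin n → ℝ} (hlam : Function.Injective lam)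
    {Q : Matrix (Fin n) (Fin n) ℝ} (hQ : Q ∈ Matrix.specialOrthogonalGroup (Fin n) ℝ) :
    bfr lam (Qᵀ * Matrix.diagonal lam * Q) = (Q * Matrix.diagonal lam * Qᵀ).diag := by
  have key : ∀ P ∈ Matrix.specialOrthogonalGroup (Fin n) ℝ,
      Qᵀ * Matrix.diagonal lam * Q = Pᵀ * Matrix.diagonal lam * P →
      (P * Matrix.diagonal lam * Pᵀ).diag = (Q * Matrix.diagonal lam * Qᵀ).diag := by
    intro P hP h
    have hQ1 : Q * Qᵀ = 1 := by
      have := (Matrix.mem_orthogonalGroup_iff (Fin n) ℝ).1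
        (Matrix.mem_specialOrthogonalGroup_iff.1 hQ).1
      simpa [Matrix.star_eq_conjTranspose] using this
    have hP1 : P * Pᵀ = 1 := by
      have := (Matrix.mem_orthogonalGroup_iff (Fin n) ℝ).1
        (Matrix.mem_specialOrthogonalGroup_iff.1 hP).1
      simpa [Matrix.star_eq_conjTranspose] using this
    have hQ2 : Qᵀ * Q = 1 := mul_eq_one_comm.1 hQ1
    have hP2 : Pᵀ * P = 1 := mul_eq_one_comm.1 hP1
    -- `E = P Qᵀ` commutes with the diagonal matrix, hence is diagonal
    have hE : (P * Qᵀ) * Matrix.diagonal lam = Matrix.diagonal lam * (P * Qᵀ) := by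
      calc (P * Qᵀ) * Matrix.diagonal lam
          = P * (Qᵀ * Matrix.diagonal lam * Q) * Qᵀ := by
            simp only [Matrix.mul_assoc, hQ1, Matrix.mul_one]
        _ = P * (Pᵀ * Matrix.diagonal lam * P) * Qᵀ := by rw [h]
        _ = (P * Pᵀ) * Matrix.diagonal lam * (P * Qᵀ) := by
            simp only [Matrix.mul_assoc]
        _ = Matrix.diagonal lam * (P * Qᵀ) := by rw [hP1, Matrix.one_mul]
    have hoff : ∀ i j, i ≠ j → (P * Qᵀ) i j = 0 := by
      intro i j hij
      have h1 := congrFun (congrFun hE i) j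
      rw [Matrix.mul_diagonal, Matrix.diagonal_mul] at h1
      have h2 : (P * Qᵀ) i j * (lam j - lam i) = 0 := by linear_combination h1
      rcases mul_eq_zero.1 h2 with h3 | h3
      · exact h3
      · exact absurd (hlam (sub_eq_zero.1 h3)).symm hij
    have hPQ : ∀ i j, P i j = (P * Qᵀ) i i * Q i j := by
      intro i j
      have h1 : P = (P * Qᵀ) * Q := by rw [Matrix.mul_assoc, hQ2, Matrix.mul_one]
      have h2 := congrFun (congrFun h1 i) j
      rw [Matrix.mul_apply, Finset.sum_eq_single i] at h2
      · exact h2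
      · intro k _ hk
        rw [hoff i k hk.symm, zero_mul]
      · intro hi
        exact absurd (Finset.mem_univ i) hi
    have hsq : ∀ i, ((P * Qᵀ) i i) ^ 2 = 1 := by
      intro i
      have h1 : (P * Qᵀ) * (P * Qᵀ)ᵀ = 1 := by
        rw [Matrix.transpose_mul, Matrix.transpose_transpose, Matrix.mul_assoc,
          ← Matrix.mul_assoc Qᵀ, hQ2, Matrix.one_mul, hP1]
      have h2 := congrFun (congrFun h1 i) i
      rw [Matrix.mul_apply, Finset.sum_eq_single i, Matrix.transpose_apply,
        Matrix.one_apply_eq] at h2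
      · rw [sq]
        exact h2
      · intro k _ hk
        rw [hoff i k hk.symm, zero_mul]
      · intro hi
        exact absurd (Finset.mem_univ i) hi
    funext i
    rw [diag_conj_apply, diag_conj_apply]
    refine Finset.sum_congr rfl fun j _ => ?_
    rw [hPQ i j, mul_pow, hsq i, one_mul]
  have hmem : Qᵀ * Matrix.diagonal lam * Q ∈ isospectral lam := ⟨Q, hQ, rfl⟩
  rw [bfr, dif_pos hmem]
  exact key _ hmem.choose_spec.1 hmem.choose_spec.2

/-- The diagonal matrices in the closure of the slice through `S`. -/
def accessibleVertices {n : ℕ} (S : Matrix (Fin n) (Fin n) ℝ) :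
    Set (Matrix (Fin n) (Fin n) ℝ) :=
  {D | D ∈ closure (slice S) ∧ D.IsDiag}

/-- The spectral polytope of `S` (with eigenvalues `lam`): the convex hull of the images of the
accessible vertices under the BFR map. -/
def spectralPolytope {n : ℕ} (lam : Fin n → ℝ) (S : Matrix (Fin n) (Fin n) ℝ) :
    Set (Fin n → ℝ) :=
  convexHull ℝ (bfr lam '' accessibleVertices S)

/-- The span of the canonical vectors `e_i`, `i ∈ I`. -/
def canonicalSubspace {n : ℕ} (I : Set (Fin n)) : Submodule ℝ (Fin n → ℝ) :=
  Submodule.span ℝ ((fun i => Pi.single i (1 : ℝ)) '' I)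

/-- `S` leaves no nontrivial canonical subspace invariant. -/
def CanonicallyIrreducible {n : ℕ} (S : Matrix (Fin n) (Fin n) ℝ) : Prop :=
  ∀ I : Set (Fin n), I.Nonempty → I ≠ Set.univ →
    ¬ ∀ v ∈ canonicalSubspace I, S *ᵥ v ∈ canonicalSubspace I

/-- Smoothness of a map on an arbitrary subset of a normed space: near every point of `s`, `f`
agrees on `s` with a smooth map defined on an open set of the ambient space. -/
def SmoothOnSubset {E F : Type*} [NormedAddCommGroup E] [NormedSpace ℝ E]
    [NormedAddCommGroup F] [NormedSpace ℝ F] (f : E → F) (s : Set E) : Prop :=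
  ∀ x ∈ s, ∃ U : Set E, IsOpen U ∧ x ∈ U ∧
    ∃ g : E → F, ContDiffOn ℝ ∞ g U ∧ Set.EqOn f g (s ∩ U)

/-- `f` restricts to a diffeomorphism from the subset `s` onto the subset `t`: a bijection that
is smooth with smooth inverse. If `t` is an open subset of an affine subspace, this says in
particular that `s` is an embedded smooth submanifold. -/
def IsDiffeomorphismOn {E F : Type*} [NormedAddCommGroup E] [NormedSpace ℝ E]
    [NormedAddCommGroup F] [NormedSpace ℝ F] (f : E → F) (s : Set E) (t : Set F) : Prop :=
  Set.BijOn f s t ∧ SmoothOnSubset f s ∧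
    ∃ g : F → E, Set.InvOn g f s t ∧ SmoothOnSubset g t

end

/-! Write `S = Q₀ᵀ Λ Q₀`. A triangular conjugation that is also an orthogonal one comes, because the
spectrum is simple, from a positive diagonal matrix acting on `Q₀`: the slice is the image under `Q
↦ Qᵀ Λ Q` of the orthogonal factors of the matrices `exp (diag t) Q₀` (`slice_eq_image`). These form
a torus orbit of oriented flags, on which the BFR map reads `Q ↦ diag (Q Λ Qᵀ)`, a moment map. The
theorem is thus a convexity theorem of Atiyah type for an orbit closure, proved here by hand in
Plücker coordinates.

The coordinates are the minors of `Q` in its leading columns. The torus multiplies the minor with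
rows `f` by `exp (∑ j, t (f j))`, up to a positive factor depending only on the number of columns.
By Cauchy–Binet and Abel summation, the pairing of `v` with the moment is, up to a constant, a
positive combination of the means of `∑ j, v (f j)` for the squared minors
(`exists_moment_pairing`). Four facts follow. A limit of the orbit lives on the face where some `u`
is maximal, and is a torus translate there (`exists_face_of_mem_closure`). Monotonicity of `exp`
makes the moment injective on the closure (`moment_injOn`). A boundary point is exposed by a
functional that is strictly smaller on the orbit (`exists_supporting_functional`). The derivative
along `v`, paired with `v`, is a sum of variances, so the inverse function theorem makes the image
of the orbit open in its affine subspace (`exists_local_section`).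

Generic functionals are maximal at monomial matrices, so the image lies in the hull of the vertices
(`moment_mem_convexHull`). Conversely, on the segment from the moment of `Q₀` to a point of the
hull, the image of the orbit is open and closed away from the endpoint (`lineMap_mem_image_moment`).
-/

noncomputable section

open Filter Topology

/-! ### Smooth QR factorization -/

section QR

open InnerProductSpace

theorem contDiff_gramSchmidt {E F : Type*} [NormedAddCommGroup E] [NormedSpace ℝ E]
    [NormedAddCommGroup F] [InnerProductSpace ℝ F] {n : ℕ} (a : E → Fin n → F)
    (ha : ∀ j, ContDiff ℝ ∞ fun t => a t j) (hli : ∀ t, LinearIndependent ℝ (a t)) (j : Fin n) :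
    ContDiff ℝ ∞ fun t => gramSchmidt ℝ (a t) j := by
  induction j using WellFoundedLT.induction with
  | _ j ih =>
    have h : (fun t => gramSchmidt ℝ (a t) j) = fun t => a t j - ∑ i ∈ Finset.Iio j,
        (inner ℝ (gramSchmidt ℝ (a t) i) (a t j) / ‖gramSchmidt ℝ (a t) i‖ ^ 2) •
          gramSchmidt ℝ (a t) i := by
      funext t
      rw [gramSchmidt_def]
      congr 1
      refine Finset.sum_congr rfl fun i _ => ?_
      rw [Submodule.starProjection_singleton]
      rfl
    rw [h]
    refine (ha j).sub (ContDiff.sum fun i hi => ?_)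
    have hi' := ih i (Finset.mem_Iio.1 hi)
    refine ContDiff.smul (ContDiff.div (hi'.inner ℝ (ha j)) (hi'.norm_sq ℝ) fun t => ?_) hi'
    have := gramSchmidt_ne_zero i (hli t)
    positivity

/-- The columns of `Q` are the normalized Gram–Schmidt vectors and `R = Qᵀ A`. It is triangular
because each such vector is orthogonal to the earlier columns of `A`, and its diagonal consists of
the norms before normalization. -/
theorem exists_contDiff_qr {E : Type*} [NormedAddCommGroup E] [NormedSpace ℝ E] {n : ℕ}
    (A : E → Matrix (Fin n) (Fin n) ℝ) (hA : ∀ i j, ContDiff ℝ ∞ fun t => A t i j)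
    (hdet : ∀ t, (A t).det ≠ 0) :
    ∃ Q : E → Matrix (Fin n) (Fin n) ℝ, (∀ i j, ContDiff ℝ ∞ fun t => Q t i j) ∧
      ∀ t, (Q t)ᵀ * Q t = 1 ∧ ∃ R ∈ UpPos n, Q t * R = A t := by
  set a : E → Fin n → EuclideanSpace ℝ (Fin n) := fun t j => WithLp.toLp 2 fun i => A t i j
    with ha_def
  have ha : ∀ j, ContDiff ℝ ∞ fun t => a t j := fun j =>
    contDiff_euclidean.2 fun i => hA i j
  have hli : ∀ t, LinearIndependent ℝ (a t) := by
    intro t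
    have h1 : LinearIndependent ℝ (A t).col :=
      Matrix.linearIndependent_cols_iff_isUnit.2 ((Matrix.isUnit_iff_isUnit_det _).2
        (isUnit_iff_ne_zero.2 (hdet t)))
    exact h1.map' (WithLp.linearEquiv 2 ℝ (Fin n → ℝ)).symm.toLinearMap (LinearEquiv.ker _)
  have hg := contDiff_gramSchmidt a ha hli
  have hne : ∀ t j, gramSchmidt ℝ (a t) j ≠ 0 := fun t j => gramSchmidt_ne_zero j (hli t)
  have hq : ∀ j, ContDiff ℝ ∞ fun t => gramSchmidtNormed ℝ (a t) j := by
    intro j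
    have h : (fun t => gramSchmidtNormed ℝ (a t) j) =
        fun t => (‖gramSchmidt ℝ (a t) j‖)⁻¹ • gramSchmidt ℝ (a t) j := by
      funext t
      simp [gramSchmidtNormed]
    rw [h]
    exact (((hg j).norm ℝ fun t => hne t j).inv fun t => norm_ne_zero_iff.2 (hne t j)).smul (hg j)
  refine ⟨fun t => Matrix.of fun i j => gramSchmidtNormed ℝ (a t) j i,
    fun i j => contDiff_euclidean.1 (hq j) i, fun t => ?_⟩
  set Q : Matrix (Fin n) (Fin n) ℝ := Matrix.of fun i j => gramSchmidtNormed ℝ (a t) j i with hQ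
  have horth : Qᵀ * Q = 1 := by
    ext i j
    have h := orthonormal_iff_ite.1 (gramSchmidtNormed_orthonormal (𝕜 := ℝ) (hli t)) i j
    rw [Matrix.mul_apply, Matrix.one_apply, ← h, PiLp.inner_apply]
    exact Finset.sum_congr rfl fun l _ => by simp [hQ, mul_comm]
  have hinner : ∀ i j, (Qᵀ * A t) i j = inner ℝ (gramSchmidtNormed ℝ (a t) i) (a t j) := by
    intro i j
    rw [Matrix.mul_apply, PiLp.inner_apply]
    exact Finset.sum_congr rfl fun l _ => by simp [hQ, ha_def, mul_comm]
  have hnormed : ∀ i j, (Qᵀ * A t) i j =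
      (‖gramSchmidt ℝ (a t) i‖)⁻¹ * inner ℝ (gramSchmidt ℝ (a t) i) (a t j) := by
    intro i j
    rw [hinner, gramSchmidtNormed, inner_smul_left]
    simp
  refine ⟨horth, Qᵀ * A t, ⟨fun i j hij => ?_, fun i => ?_⟩, ?_⟩
  · have hij' : j < i := hij
    rw [hnormed, gramSchmidt_inv_triangular ℝ (a t) hij', mul_zero]
  · have h1 : inner ℝ (gramSchmidt ℝ (a t) i) (a t i) = ‖gramSchmidt ℝ (a t) i‖ ^ 2 := by
      rw [← real_inner_self_eq_norm_sq]
      conv_lhs => rw [gramSchmidt_def'' ℝ (a t) i]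
      rw [inner_add_right, inner_sum, Finset.sum_eq_zero, add_zero]
      intro l hl
      rw [inner_smul_right, gramSchmidt_orthogonal ℝ (a t) (Finset.mem_Iio.1 hl).ne', mul_zero]
    rw [hnormed, h1]
    have := norm_pos_iff.2 (hne t i)
    positivity
  · rw [← Matrix.mul_assoc, mul_eq_one_comm.1 horth, Matrix.one_mul]

end QR

/-! ### Cauchy–Binet and first moments of squared minors -/

section CauchyBinet

variable {m ι : Type*} [Fintype m] [Fintype ι] [DecidableEq ι]

/-- The Cauchy–Binet formula, summed over all maps instead of over subsets. -/
theorem factorial_mul_det_transpose_mul (A B : Matrix m ι ℝ) :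
    ((Fintype.card ι).factorial : ℝ) * (Aᵀ * B).det =
      ∑ f : ι → m, (A.submatrix f id).det * (B.submatrix f id).det := by
  classical
  have h1 : (Aᵀ * B).det = ∑ f : ι → m, (∏ i, B (f i) i) * (A.submatrix f id).det := by
    calc (Aᵀ * B).det = ∑ σ : Equiv.Perm ι, ((σ.sign : ℤ) : ℝ) *
          ∏ i, ∑ l, A l (σ i) * B l i := by
          rw [Matrix.det_apply']
          rfl
      _ = ∑ σ : Equiv.Perm ι, ∑ f : ι → m,
          ((σ.sign : ℤ) : ℝ) * ∏ i, (A (f i) (σ i) * B (f i) i) := by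
          refine Finset.sum_congr rfl fun σ _ => ?_
          rw [Finset.prod_univ_sum, Finset.mul_sum, Fintype.piFinset_univ]
      _ = ∑ f : ι → m, (∏ i, B (f i) i) * (A.submatrix f id).det := by
          rw [Finset.sum_comm]
          refine Finset.sum_congr rfl fun f _ => ?_
          rw [← Matrix.det_transpose, Matrix.det_apply', Finset.mul_sum]
          refine Finset.sum_congr rfl fun σ _ => ?_
          rw [Finset.prod_mul_distrib]
          simp only [Matrix.transpose_apply, Matrix.submatrix_apply, id]
          ring
  -- Reindexing `f` by `σ` permutes the rows of the minor of `A` and costs a sign. Summing over all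
  -- `σ` then rebuilds the minor of `B`, which accounts for the factorial.
  have h2 : ∀ σ : Equiv.Perm ι, (Aᵀ * B).det = ∑ f : ι → m,
      (((σ.sign : ℤ) : ℝ) * ∏ i, B (f (σ i)) i) * (A.submatrix f id).det := by
    intro σ
    rw [h1, ← Equiv.sum_comp (Equiv.arrowCongr σ (Equiv.refl m)).symm]
    refine Finset.sum_congr rfl fun f _ => ?_
    have h3 : ((A.submatrix f id).submatrix σ id).det =
        ((σ.sign : ℤ) : ℝ) * (A.submatrix f id).det := Matrix.det_permute σ _
    have h4 : A.submatrix ((Equiv.arrowCongr σ (Equiv.refl m)).symm f) id =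
        (A.submatrix f id).submatrix σ id := rfl
    rw [h4, h3]
    simp only [Equiv.arrowCongr_symm, Equiv.arrowCongr_apply, Function.comp_apply,
      Equiv.symm_symm, Equiv.refl_symm, Equiv.refl_apply]
    ring
  calc ((Fintype.card ι).factorial : ℝ) * (Aᵀ * B).det
      = ∑ _σ : Equiv.Perm ι, (Aᵀ * B).det := by
        rw [Finset.sum_const, Finset.card_univ, Fintype.card_perm, nsmul_eq_mul]
    _ = ∑ σ : Equiv.Perm ι, ∑ f : ι → m,
          (((σ.sign : ℤ) : ℝ) * ∏ i, B (f (σ i)) i) * (A.submatrix f id).det :=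
        Finset.sum_congr rfl fun σ _ => h2 σ
    _ = _ := by
        rw [Finset.sum_comm]
        refine Finset.sum_congr rfl fun f _ => ?_
        rw [← Finset.sum_mul, mul_comm, Matrix.det_apply' (B.submatrix f id)]
        rfl

variable [DecidableEq m]

theorem det_submatrix_diagonal_mul (x : m → ℝ) (B : Matrix m ι ℝ) (f : ι → m) :
    ((Matrix.diagonal x * B).submatrix f id).det =
      (∏ i, x (f i)) * (B.submatrix f id).det := by
  rw [← Matrix.det_mul_column]
  congr 1
  ext i j
  simp [Matrix.diagonal_mul]

/-- First moments of the distribution of squared maximal minors of a matrix with orthonormal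
columns. -/
theorem sum_det_sq_mul_sum (B : Matrix m ι ℝ) (hB : Bᵀ * B = 1) (v : m → ℝ) :
    ∑ f : ι → m, (B.submatrix f id).det ^ 2 * ∑ i, v (f i) =
      ((Fintype.card ι).factorial : ℝ) * ∑ l, v l * ∑ i, B l i ^ 2 := by
  -- Cauchy–Binet for `Bᵀ (1 + s diag v) B` yields an identity in `s`. Its derivative at `0` is a
  -- trace on the left and the first moment on the right.
  have h1 : ∀ s : ℝ, ((Fintype.card ι).factorial : ℝ) *
      (1 + s • (Bᵀ * Matrix.diagonal v * B)).det =
        ∑ f : ι → m, (B.submatrix f id).det ^ 2 * ∏ i, (1 + s * v (f i)) := by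
    intro s
    have h2 : 1 + s • (Bᵀ * Matrix.diagonal v * B) =
        Bᵀ * (Matrix.diagonal (fun l => 1 + s * v l) * B) := by
      have h3 : Matrix.diagonal (fun l => 1 + s * v l) =
          (1 : Matrix m m ℝ) + s • Matrix.diagonal v := by
        rw [← Matrix.diagonal_one, ← Matrix.diagonal_smul, Matrix.diagonal_add]
        rfl
      rw [h3, Matrix.add_mul, Matrix.mul_add, Matrix.one_mul, hB, Matrix.smul_mul,
        Matrix.mul_smul, Matrix.mul_assoc]
    rw [h2, factorial_mul_det_transpose_mul]
    refine Finset.sum_congr rfl fun f _ => ?_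
    rw [det_submatrix_diagonal_mul]
    ring
  have hL : HasDerivAt (fun s : ℝ => ((Fintype.card ι).factorial : ℝ) *
      (1 + s • (Bᵀ * Matrix.diagonal v * B)).det)
      (((Fintype.card ι).factorial : ℝ) * (Bᵀ * Matrix.diagonal v * B).trace) 0 := by
    refine HasDerivAt.const_mul _ ?_
    rw [funext fun s : ℝ => Matrix.det_one_add_smul s (Bᵀ * Matrix.diagonal v * B)]
    have hp := (Polynomial.hasDerivAt ((1 + (Polynomial.X : Polynomial ℝ) •
        (Bᵀ * Matrix.diagonal v * B).map Polynomial.C).det.divX.divX) (0 : ℝ))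
    have := (((hasDerivAt_id (0 : ℝ)).const_mul (Bᵀ * Matrix.diagonal v * B).trace).const_add
      1).add (hp.mul ((hasDerivAt_id (0 : ℝ)).pow 2))
    exact this.congr_deriv (by simp)
  have hR : HasDerivAt (fun s : ℝ => ∑ f : ι → m, (B.submatrix f id).det ^ 2 *
      ∏ i, (1 + s * v (f i)))
      (∑ f : ι → m, (B.submatrix f id).det ^ 2 * ∑ i, v (f i)) 0 := by
    refine HasDerivAt.fun_sum fun f _ => HasDerivAt.const_mul _ ?_
    have := HasDerivAt.fun_finsetProd (u := (Finset.univ : Finset ι))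
      (f := fun i (s : ℝ) => 1 + s * v (f i)) (f' := fun i => v (f i)) (x := (0 : ℝ))
      (fun i _ => by simpa using ((hasDerivAt_id (0 : ℝ)).mul_const (v (f i))).const_add 1)
    simpa using this
  have h3 := hL.unique ((funext h1) ▸ hR)
  rw [← h3, Matrix.trace_mul_comm, ← Matrix.mul_assoc]
  congr 1
  rw [Matrix.trace]
  refine Finset.sum_congr rfl fun l _ => ?_
  rw [Matrix.diag_apply, Matrix.mul_diagonal, Matrix.mul_apply, mul_comm]
  congr 1
  exact Finset.sum_congr rfl fun i _ => by rw [Matrix.transpose_apply, sq]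

end CauchyBinet

/-! ### Plücker coordinates of an orthogonal matrix -/

/-- The inclusion of the indices up to `k`. -/
abbrev upTo {n : ℕ} (k : Fin n) : {j // j ≤ k} → Fin n := Subtype.val

/-- The minor of `Q` in the rows `f` and the columns up to `k`. -/
def minor {n : ℕ} (Q : Matrix (Fin n) (Fin n) ℝ) (k : Fin n) (f : {j // j ≤ k} → Fin n) : ℝ :=
  (Q.submatrix f (upTo k)).det

/-- The diagonal of `Q Λ Qᵀ`. -/
def moment {n : ℕ} (lam : Fin n → ℝ) (Q : Matrix (Fin n) (Fin n) ℝ) (i : Fin n) : ℝ :=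
  ∑ j, lam j * Q i j ^ 2

section Minors

variable {n : ℕ}

theorem continuous_minor (k : Fin n) (f : {j // j ≤ k} → Fin n) :
    Continuous fun Q : Matrix (Fin n) (Fin n) ℝ => minor Q k f :=
  (continuous_id.matrix_submatrix _ _).matrix_det

theorem continuous_moment (lam : Fin n → ℝ) : Continuous (moment lam) := by
  refine continuous_pi fun i => continuous_finsetSum _ fun j _ => ?_
  exact continuous_const.mul ((continuous_id.matrix_elem i j).pow 2)

theorem leading_transpose_mul (Q Q' : Matrix (Fin n) (Fin n) ℝ) (k : Fin n) :
    (Q.submatrix id (upTo k))ᵀ * Q'.submatrix id (upTo k) =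
      (Qᵀ * Q').submatrix Subtype.val Subtype.val := by
  ext i j
  simp [Matrix.mul_apply]

theorem leading_one (k : Fin n) :
    (1 : Matrix (Fin n) (Fin n) ℝ).submatrix (upTo k) (upTo k) =
      1 :=
  Matrix.submatrix_one _ Subtype.val_injective

/-- The factorial appears because `f` runs over all maps: each set of rows is counted once per
ordering, and non-injective maps contribute zero. -/
theorem sum_minor_mul_minor (Q Q' : Matrix (Fin n) (Fin n) ℝ) (k : Fin n) :
    ∑ f, minor Q k f * minor Q' k f = ((Fintype.card {j // j ≤ k}).factorial : ℝ) *
      ((Qᵀ * Q').submatrix (upTo k) (upTo k)).det := by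
  rw [← leading_transpose_mul, factorial_mul_det_transpose_mul]
  rfl

theorem sum_minor_sq {Q : Matrix (Fin n) (Fin n) ℝ} (hQ : Qᵀ * Q = 1) (k : Fin n) :
    ∑ f, minor Q k f ^ 2 = ((Fintype.card {j // j ≤ k}).factorial : ℝ) := by
  simp only [sq]
  rw [sum_minor_mul_minor, hQ, leading_one, Matrix.det_one, mul_one]

theorem sum_minor_sq_pos {Q : Matrix (Fin n) (Fin n) ℝ} (hQ : Qᵀ * Q = 1) (k : Fin n) :
    0 < ∑ f, minor Q k f ^ 2 := by
  rw [sum_minor_sq hQ]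
  exact_mod_cast Nat.factorial_pos _

theorem exists_minor_ne_zero {Q : Matrix (Fin n) (Fin n) ℝ} (hQ : Qᵀ * Q = 1) (k : Fin n) :
    ∃ f, minor Q k f ≠ 0 := by
  by_contra! h
  simpa [h] using sum_minor_sq_pos hQ k

theorem sum_minor_sq_mul {Q : Matrix (Fin n) (Fin n) ℝ} (hQ : Qᵀ * Q = 1) (k : Fin n)
    (v : Fin n → ℝ) :
    ∑ f, minor Q k f ^ 2 * ∑ j, v (f j) = ((Fintype.card {j // j ≤ k}).factorial : ℝ) *
      ∑ i, v i * ∑ j : {j // j ≤ k}, Q i j ^ 2 := by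
  have h := sum_det_sq_mul_sum (Q.submatrix id (upTo k))
    (by rw [leading_transpose_mul, hQ, leading_one]) v
  exact h

theorem minor_eq_zero_of_not_injective (Q : Matrix (Fin n) (Fin n) ℝ) (k : Fin n)
    (f : {j // j ≤ k} → Fin n) (hf : ¬ Function.Injective f) : minor Q k f = 0 := by
  rw [Function.Injective] at hf
  push Not at hf
  obtain ⟨a, b, hab, hne⟩ := hf
  exact Matrix.det_zero_of_row_eq hne (by ext j; simp [hab])

/-- The leading columns of `Q * R` only involve the leading columns of `Q`, through the leading
block of `R`. So right multiplication by triangular matrices rescales all minors of the same `k`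
alike. -/
theorem minor_mul_of_blockTriangular (Q : Matrix (Fin n) (Fin n) ℝ)
    {R : Matrix (Fin n) (Fin n) ℝ} (hR : R.BlockTriangular id) (k : Fin n)
    (f : {j // j ≤ k} → Fin n) :
    minor (Q * R) k f = minor Q k f * ∏ j : {j // j ≤ k}, R j j := by
  have h1 : (Q * R).submatrix f (upTo k) = Q.submatrix f (upTo k) *
      R.submatrix (upTo k) (upTo k) := by
    ext i j
    rw [Matrix.submatrix_apply, Matrix.mul_apply, Matrix.mul_apply]
    simp only [Matrix.submatrix_apply]
    rw [← Finset.sum_subtype (Finset.Iic k) (fun l => by simp) fun l => Q (f i) l * R l j]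
    refine (Finset.sum_subset (Finset.subset_univ _) fun l _ hl => ?_).symm
    have : (j : Fin n) < l := lt_of_le_of_lt j.2 (by simpa using hl)
    rw [hR this, mul_zero]
  have h2 : (R.submatrix (upTo k) (upTo k)).BlockTriangular id :=
    fun i j hij => hR (show (j : Fin n) < i from hij)
  rw [minor, h1, Matrix.det_mul, Matrix.det_of_isUpperTriangular h2]
  rfl

theorem minor_diagonal_mul (x : Fin n → ℝ) (Q : Matrix (Fin n) (Fin n) ℝ) (k : Fin n)
    (f : {j // j ≤ k} → Fin n) :
    minor (Matrix.diagonal x * Q) k f = (∏ j, x (f j)) * minor Q k f := by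
  rw [minor, minor, ← Matrix.det_mul_column]
  congr 1
  ext i j
  simp [Matrix.diagonal_mul]

theorem exists_minor_eq_of_mul_eq {Q Q₀ R : Matrix (Fin n) (Fin n) ℝ} {t : Fin n → ℝ}
    (hR : R ∈ UpPos n) (h : Q * R = Matrix.diagonal (fun i => Real.exp (t i)) * Q₀) :
    ∃ ρ : Fin n → ℝ, ∀ k, 0 < ρ k ∧ ∀ f, minor Q k f =
      ρ k * Real.exp (∑ j, t (f j)) * minor Q₀ k f := by
  have hpos : ∀ k, 0 < ∏ j : {j // j ≤ k}, R (upTo k j) (upTo k j) := fun k =>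
    Finset.prod_pos fun j _ => hR.2 (upTo k j)
  refine ⟨fun k => (∏ j : {j // j ≤ k}, R j j)⁻¹, fun k => ⟨inv_pos.2 (hpos k), fun f => ?_⟩⟩
  have h1 := minor_mul_of_blockTriangular Q hR.1 k f
  rw [h, minor_diagonal_mul, ← Real.exp_sum] at h1
  rw [mul_assoc, h1]
  field_simp [(hpos k).ne']

/-- An orthogonal matrix is determined by the lines spanned by its Plücker vectors, with
orientation. -/
theorem eq_of_minor_eq {Q Q' : Matrix (Fin n) (Fin n) ℝ} (hQ : Qᵀ * Q = 1) (hQ' : Q'ᵀ * Q' = 1)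
    (h : ∀ k, ∃ c : ℝ, 0 < c ∧ ∀ f, minor Q k f = c * minor Q' k f) : Q = Q' := by
  -- Both Plücker vectors have the same norm, so the positive constant is `1`.
  have hminor : ∀ k f, minor Q k f = minor Q' k f := by
    intro k f
    obtain ⟨c, hc, hcf⟩ := h k
    have h1 : c ^ 2 * ∑ f, minor Q' k f ^ 2 = ∑ f, minor Q' k f ^ 2 := by
      rw [sum_minor_sq hQ', ← sum_minor_sq hQ k]
      conv_lhs => rw [sum_minor_sq hQ, ← sum_minor_sq hQ', Finset.mul_sum]
      exact Finset.sum_congr rfl fun f _ => by rw [hcf f]; ring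
    have h2 : c ^ 2 = 1 := by
      have := sum_minor_sq_pos hQ' k
      exact mul_right_cancel₀ this.ne' (by rw [h1, one_mul])
    have h3 : c = 1 := by nlinarith
    rw [hcf, h3, one_mul]
  set E := Qᵀ * Q' with hE
  have hQQ : Q * Qᵀ = 1 := mul_eq_one_comm.1 hQ
  have hQQ' : Q' * Q'ᵀ = 1 := mul_eq_one_comm.1 hQ'
  have hE1 : E * Eᵀ = 1 := by
    rw [hE, Matrix.transpose_mul, Matrix.transpose_transpose, Matrix.mul_assoc,
      ← Matrix.mul_assoc Q', hQQ', Matrix.one_mul, hQ]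
  have hE2 : Eᵀ * E = 1 := mul_eq_one_comm.1 hE1
  -- Cauchy–Binet turns the equality of the Plücker vectors into leading principal minors equal to
  -- `1`.
  have hdet : ∀ k : Fin n,
      (E.submatrix (upTo k) (upTo k)).det = 1 := by
    intro k
    have h1 := sum_minor_mul_minor Q Q' k
    simp only [← hminor, ← sq] at h1
    rw [sum_minor_sq hQ] at h1
    have h2 : ((Fintype.card {j // j ≤ k}).factorial : ℝ) ≠ 0 := by
      exact_mod_cast Nat.factorial_ne_zero _
    exact (mul_left_cancel₀ h2 (by rw [mul_one]; exact h1)).symm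
  -- Once the earlier rows and columns of `E` are those of the identity, the leading minor is `E k
  -- k`. An orthogonal matrix with a diagonal entry `1` vanishes on the rest of that row and column.
  have key : ∀ k : Fin n, ∀ j, E k j = (1 : Matrix (Fin n) (Fin n) ℝ) k j ∧
      E j k = (1 : Matrix (Fin n) (Fin n) ℝ) j k := by
    intro k
    induction k using WellFoundedLT.induction with
    | _ k ih =>
      have hlead : E.submatrix (upTo k) (upTo k) =
          Matrix.diagonal fun j : {j // j ≤ k} => E j j := by
        ext i j
        rcases eq_or_ne i j with rfl | hij
        · simp
        · rw [Matrix.diagonal_apply_ne _ hij, Matrix.submatrix_apply]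
          have hij' : (i : Fin n) ≠ j := fun h => hij (Subtype.ext h)
          rcases lt_or_gt_of_ne hij' with hlt | hlt
          · rw [(ih i (lt_of_lt_of_le hlt j.2) j).1, Matrix.one_apply_ne hij']
          · rw [(ih j (lt_of_lt_of_le hlt i.2) i).2, Matrix.one_apply_ne hij']
      have hkk : E k k = 1 := by
        have h1 := hdet k
        rw [hlead, Matrix.det_diagonal, Finset.prod_eq_single ⟨k, le_rfl⟩] at h1
        · exact h1
        · intro j _ hj
          have : (j : Fin n) < k := lt_of_le_of_ne j.2 fun h => hj (Subtype.ext h)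
          rw [(ih j this j).1, Matrix.one_apply_eq]
        · simp
      have hrow : ∀ F : Matrix (Fin n) (Fin n) ℝ, F * Fᵀ = 1 → F k k = 1 → ∀ j, j ≠ k →
          F k j = 0 := by
        intro F hF hFk j hj
        have h1 := congrFun (congrFun hF k) k
        rw [Matrix.mul_apply, Matrix.one_apply_eq,
          ← Finset.add_sum_erase _ _ (Finset.mem_univ k), Matrix.transpose_apply, hFk] at h1
        have h2 : ∑ l ∈ Finset.univ.erase k, F k l * Fᵀ l k = 0 := by linarith
        have h3 := (Finset.sum_eq_zero_iff_of_nonneg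
          (fun l _ => mul_self_nonneg (F k l))).1 h2 j (by simp [hj])
        exact mul_self_eq_zero.1 h3
      intro j
      rcases eq_or_ne j k with rfl | hj
      · simp [hkk]
      · rw [Matrix.one_apply_ne hj, Matrix.one_apply_ne hj.symm]
        exact ⟨hrow E hE1 hkk j hj, hrow Eᵀ (by simpa using hE2) hkk j hj⟩
  have hE3 : E = 1 := by
    ext i j
    exact (key i j).1
  calc Q = Q * E := by rw [hE3, Matrix.mul_one]
    _ = Q' := by rw [hE, ← Matrix.mul_assoc, hQQ, Matrix.one_mul]

end Minors

/-! ### The moment as a positive combination of means -/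

section Abel

variable {n : ℕ}

theorem StrictAnti.exists_eq_add_sum {lam : Fin n → ℝ} (hlam : StrictAnti lam) :
    ∃ (c : ℝ) (w : Fin n → ℝ), (∀ k, 0 < w k) ∧
      ∀ j, lam j = c + ∑ k, if j ≤ k then w k else 0 := by
  obtain ⟨b, hb⟩ := (Set.finite_range lam).bddBelow
  have hb' : ∀ i, b - 1 < lam i := fun i => by
    have := hb ⟨i, rfl⟩
    linarith
  -- The weights are the gaps between consecutive eigenvalues. A value below all of them is appended
  -- so that the last gap is positive too.
  let μ : ℕ → ℝ := fun i => if h : i < n then lam ⟨i, h⟩ else b - 1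
  have hμ : ∀ i : Fin n, μ i = lam i := fun i => by simp [μ]
  refine ⟨b - 1, fun k => μ k - μ (k + 1), fun k => ?_, fun j => ?_⟩
  · rw [sub_pos, hμ]
    by_cases h : (k : ℕ) + 1 < n
    · simp only [μ, h, dif_pos]
      exact hlam (Fin.lt_def.2 (Nat.lt_succ_self k))
    · simp only [μ, h, dif_neg, not_false_iff]
      exact hb' k
  · have h1 : (∑ k : Fin n, if j ≤ k then μ k - μ (k + 1) else 0) =
        ∑ i ∈ Finset.range n, if (j : ℕ) ≤ i then μ i - μ (i + 1) else 0 :=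
      Fin.sum_univ_eq_sum_range (fun i => if (j : ℕ) ≤ i then μ i - μ (i + 1) else 0) n
    have h2 : ∀ m, (j : ℕ) ≤ m → (∑ i ∈ Finset.range m,
        if (j : ℕ) ≤ i then μ i - μ (i + 1) else 0) = μ j - μ m := by
      intro m hm
      induction m, hm using Nat.le_induction with
      | base =>
        rw [sub_self]
        exact Finset.sum_eq_zero fun i hi => if_neg (not_le.2 (Finset.mem_range.1 hi))
      | succ m hm ih =>
        rw [Finset.sum_range_succ, ih, if_pos hm]
        ring
    rw [h1, h2 n j.2.le, hμ]
    simp [μ]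

/-- Abel summation reduces the moment to row sums of squares over leading columns, which
Cauchy–Binet expresses through squared minors. Each `W k` is a gap of eigenvalues divided by the
number of orderings; its positivity drives all the convexity arguments. -/
theorem exists_moment_pairing {lam : Fin n → ℝ} (hlam : StrictAnti lam) :
    ∃ (c : ℝ) (W : Fin n → ℝ), (∀ k, 0 < W k) ∧
      ∀ Q : Matrix (Fin n) (Fin n) ℝ, Qᵀ * Q = 1 → ∀ v : Fin n → ℝ,
        ∑ i, v i * moment lam Q i =
          c * ∑ i, v i + ∑ k, W k * ∑ f, minor Q k f ^ 2 * ∑ j, v (f j) := by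
  obtain ⟨c, w, hw, hlamw⟩ := hlam.exists_eq_add_sum
  have hfac : ∀ k : Fin n, (0 : ℝ) < ((Fintype.card {j // j ≤ k}).factorial : ℝ) := fun k => by
    exact_mod_cast Nat.factorial_pos _
  refine ⟨c, fun k => w k / ((Fintype.card {j // j ≤ k}).factorial : ℝ),
    fun k => div_pos (hw k) (hfac k), fun Q hQ v => ?_⟩
  have hrow : ∀ i, ∑ j, Q i j ^ 2 = 1 := by
    intro i
    have hQ1 : Q * Qᵀ = 1 := mul_eq_one_comm.1 hQ
    have h1 := congrFun (congrFun hQ1 i) i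
    rw [Matrix.mul_apply, Matrix.one_apply_eq] at h1
    rw [← h1]
    exact Finset.sum_congr rfl fun j _ => by rw [Matrix.transpose_apply, sq]
  have hmom : ∀ i, moment lam Q i = c + ∑ k, w k * ∑ j : {j // j ≤ k}, Q i j ^ 2 := by
    intro i
    have h1 : ∀ k : Fin n, ∑ j : {j // j ≤ k}, Q i j ^ 2 =
        ∑ j, if j ≤ k then Q i j ^ 2 else 0 := by
      intro k
      rw [← Finset.sum_filter]
      exact (Finset.sum_subtype (Finset.univ.filter (· ≤ k)) (fun l => by simp)
        fun l => Q i l ^ 2).symm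
    simp only [moment, hlamw, add_mul, Finset.sum_add_distrib, ← Finset.mul_sum, hrow, mul_one,
      h1, Finset.sum_mul]
    rw [Finset.sum_comm]
    congr 1
    refine Finset.sum_congr rfl fun k _ => ?_
    rw [Finset.mul_sum]
    exact Finset.sum_congr rfl fun j _ => by split_ifs <;> simp
  have h2 : ∀ k, w k / ((Fintype.card {j // j ≤ k}).factorial : ℝ) *
      ∑ f, minor Q k f ^ 2 * ∑ j, v (f j) =
        ∑ i, v i * (w k * ∑ j : {j // j ≤ k}, Q i j ^ 2) := by
    intro k
    rw [sum_minor_sq_mul hQ, ← mul_assoc, div_mul_cancel₀ _ (hfac k).ne', Finset.mul_sum]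
    exact Finset.sum_congr rfl fun i _ => by ring
  simp only [h2, hmom]
  rw [Finset.sum_comm, Finset.mul_sum, ← Finset.sum_add_distrib]
  refine Finset.sum_congr rfl fun i _ => ?_
  rw [← Finset.mul_sum]
  ring

end Abel

/-! ### The torus orbit and its limits -/

/-- The orthogonal factors of the matrices `exp (diag t) Q₀`. -/
def qrOrbit {n : ℕ} (Q₀ : Matrix (Fin n) (Fin n) ℝ) : Set (Matrix (Fin n) (Fin n) ℝ) :=
  {Q | Q ∈ Matrix.specialOrthogonalGroup (Fin n) ℝ ∧ ∃ t : Fin n → ℝ, ∃ R ∈ UpPos n,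
    Q * R = Matrix.diagonal (fun i => Real.exp (t i)) * Q₀}

/-- The range is closed and has a continuous linear section. This replaces possibly divergent torus
parameters by convergent ones with the same effect under `L`. -/
theorem LinearMap.exists_tendsto_lift {E F : Type*} [NormedAddCommGroup E] [NormedSpace ℝ E]
    [NormedAddCommGroup F] [NormedSpace ℝ F] [FiniteDimensional ℝ F] (L : E →ₗ[ℝ] F)
    {x : ℕ → E} {y : F} (h : Tendsto (fun m => L (x m)) atTop (𝓝 y)) :
    ∃ (τ : E) (v : ℕ → E), Tendsto v atTop (𝓝 τ) ∧ (∀ m, L (v m) = L (x m)) ∧ L τ = y := by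
  have hy : y ∈ L.range := by
    have hc : IsClosed (L.range : Set F) := L.range.closed_of_finiteDimensional
    exact hc.mem_of_tendsto h (Eventually.of_forall fun m => ⟨x m, rfl⟩)
  obtain ⟨G, hG⟩ := L.rangeRestrict.exists_rightInverse_of_surjective L.range_rangeRestrict
  have hG' : ∀ z : L.range, L (G z) = z := fun z =>
    congrArg Subtype.val (LinearMap.congr_fun hG z)
  refine ⟨G ⟨y, hy⟩, fun m => G ⟨L (x m), ⟨x m, rfl⟩⟩, ?_, fun m => hG' _, hG' _⟩
  exact (G.continuous_of_finiteDimensional.tendsto _).comp (tendsto_subtype_rng.2 h)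

section Closure

variable {n : ℕ} {Q Q₀ : Matrix (Fin n) (Fin n) ℝ}

theorem transpose_mul_self_of_mem (hQ : Q ∈ Matrix.specialOrthogonalGroup (Fin n) ℝ) :
    Qᵀ * Q = 1 :=
  (Matrix.mem_orthogonalGroup_iff' (Fin n) ℝ).1 (Matrix.mem_specialOrthogonalGroup_iff.1 hQ).1

theorem mem_specialOrthogonalGroup_of (h : Qᵀ * Q = 1) (hdet : 0 < Q.det) :
    Q ∈ Matrix.specialOrthogonalGroup (Fin n) ℝ := by
  refine Matrix.mem_specialOrthogonalGroup_iff.2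
    ⟨(Matrix.mem_orthogonalGroup_iff' (Fin n) ℝ).2 h, ?_⟩
  have h1 := congrArg Matrix.det h
  rw [Matrix.det_mul, Matrix.det_transpose, Matrix.det_one] at h1
  nlinarith

theorem isCompact_specialOrthogonalGroup :
    IsCompact (Matrix.specialOrthogonalGroup (Fin n) ℝ : Set (Matrix (Fin n) (Fin n) ℝ)) := by
  refine Metric.isCompact_of_isClosed_isBounded ?_ ?_
  · have h : (Matrix.specialOrthogonalGroup (Fin n) ℝ : Set (Matrix (Fin n) (Fin n) ℝ)) =
        {Q | Qᵀ * Q = 1} ∩ {Q | Q.det = 1} := by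
      ext Q
      exact Matrix.mem_specialOrthogonalGroup_iff.trans
        (and_congr_left fun _ => Matrix.mem_orthogonalGroup_iff' (Fin n) ℝ)
    rw [h]
    exact (isClosed_eq (continuous_id.matrix_transpose.matrix_mul continuous_id)
      continuous_const).inter (isClosed_eq continuous_id.matrix_det continuous_const)
  · refine isBounded_iff_forall_norm_le.2 ⟨1, fun Q hQ => ?_⟩
    refine (Matrix.norm_le_iff zero_le_one).2 fun i j => ?_
    have h1 := congrFun (congrFun (transpose_mul_self_of_mem hQ) j) j
    rw [Matrix.mul_apply, Matrix.one_apply_eq] at h1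
    have h2 : Qᵀ j i * Q i j ≤ 1 := h1 ▸
      Finset.single_le_sum (f := fun l => Qᵀ j l * Q l j) (fun l _ => mul_self_nonneg (Q l j))
        (Finset.mem_univ i)
    rw [Matrix.transpose_apply] at h2
    rw [Real.norm_eq_abs, abs_le]
    constructor <;> nlinarith

theorem closure_qrOrbit_subset :
    closure (qrOrbit Q₀) ⊆ (Matrix.specialOrthogonalGroup (Fin n) ℝ : Set _) :=
  closure_minimal (fun _ h => h.1) isCompact_specialOrthogonalGroup.isClosed

theorem isCompact_closure_qrOrbit : IsCompact (closure (qrOrbit Q₀)) :=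
  isCompact_specialOrthogonalGroup.of_isClosed_subset isClosed_closure closure_qrOrbit_subset

theorem det_pos_of_mem_upPos {R : Matrix (Fin n) (Fin n) ℝ} (hR : R ∈ UpPos n) : 0 < R.det := by
  rw [Matrix.det_of_isUpperTriangular hR.1]
  exact Finset.prod_pos fun i _ => hR.2 i

theorem mem_specialOrthogonalGroup_of_mul_eq
    (h₀ : Q₀ ∈ Matrix.specialOrthogonalGroup (Fin n) ℝ) (hQ : Qᵀ * Q = 1) {d : Fin n → ℝ}
    (hd : ∀ i, 0 < d i)
    {R : Matrix (Fin n) (Fin n) ℝ} (hR : R ∈ UpPos n) (h : Q * R = Matrix.diagonal d * Q₀) :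
    Q ∈ Matrix.specialOrthogonalGroup (Fin n) ℝ := by
  refine mem_specialOrthogonalGroup_of hQ ?_
  have h1 := congrArg Matrix.det h
  rw [Matrix.det_mul, Matrix.det_mul, Matrix.det_diagonal,
    (Matrix.mem_specialOrthogonalGroup_iff.1 h₀).2, mul_one] at h1
  have h2 : 0 < ∏ i, d i := Finset.prod_pos fun i _ => hd i
  rw [← h1] at h2
  exact (pos_iff_pos_of_mul_pos h2).2 (det_pos_of_mem_upPos hR)

theorem exists_qrOrbit_param (h₀ : Q₀ ∈ Matrix.specialOrthogonalGroup (Fin n) ℝ) :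
    ∃ N : (Fin n → ℝ) → Matrix (Fin n) (Fin n) ℝ,
      (∀ i j, ContDiff ℝ ∞ fun t => N t i j) ∧
      ∀ t, N t ∈ Matrix.specialOrthogonalGroup (Fin n) ℝ ∧
        ∃ R ∈ UpPos n, N t * R = Matrix.diagonal (fun i => Real.exp (t i)) * Q₀ := by
  obtain ⟨N, hN, h⟩ := exists_contDiff_qr
    (fun t : Fin n → ℝ => Matrix.diagonal (fun i => Real.exp (t i)) * Q₀)
    (fun i j => by
      simp only [Matrix.diagonal_mul]
      exact ((contDiff_apply ℝ ℝ i).exp).mul contDiff_const)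
    (fun t => by
      rw [Matrix.det_mul, Matrix.det_diagonal, (Matrix.mem_specialOrthogonalGroup_iff.1 h₀).2,
        mul_one]
      exact (Finset.prod_pos fun i _ => Real.exp_pos (t i)).ne')
  refine ⟨N, hN, fun t => ?_⟩
  obtain ⟨hO, R, hR, hNR⟩ := h t
  exact ⟨mem_specialOrthogonalGroup_of_mul_eq h₀ hO (fun i => Real.exp_pos (t i)) hR hNR,
    R, hR, hNR⟩

/-- A limit of orthogonal factors of `exp (diag t) Q₀` is described by a face (the rows of minors
maximizing `u`) and a point `τ` of the corresponding torus orbit. -/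
theorem exists_face_of_mem_closure (hQ : Q ∈ closure (qrOrbit Q₀)) :
    ∃ (τ u ρ h : Fin n → ℝ), (∀ k, 0 < ρ k) ∧ ∀ k f,
      (minor Q₀ k f = 0 → minor Q k f = 0) ∧
      (minor Q₀ k f ≠ 0 →
        (∑ j, u (f j) = h k ∧
          minor Q k f = ρ k * Real.exp (∑ j, τ (f j)) * minor Q₀ k f) ∨
        (∑ j, u (f j) < h k ∧ minor Q k f = 0)) := by
  have : FrechetUrysohnSpace (Matrix (Fin n) (Fin n) ℝ) :=
    inferInstanceAs (FrechetUrysohnSpace (Fin n → Fin n → ℝ))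
  obtain ⟨q, hq, hlim⟩ := mem_closure_iff_seq_limit.1 hQ
  choose hqSO t R hR hqR using hq
  choose r hr hrf using fun m => exists_minor_eq_of_mul_eq (hR m) (hqR m)
  have horth := transpose_mul_self_of_mem (closure_qrOrbit_subset hQ)
  have hminor : ∀ k f, Tendsto (fun m => minor (q m) k f) atTop (𝓝 (minor Q k f)) :=
    fun k f => ((continuous_minor k f).tendsto Q).comp hlim
  have hzero : ∀ k f, minor Q₀ k f = 0 → minor Q k f = 0 := by
    intro k f h0
    have h1 := hminor k f
    simp only [hrf, h0, mul_zero] at h1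
    exact (tendsto_nhds_unique h1 tendsto_const_nhds)
  -- For each `k`, `b k` is a choice of rows whose minor survives in the limit. Ratios to this minor
  -- eliminate the unknown factors `r m k`.
  choose b hb using exists_minor_ne_zero horth
  have hb0 : ∀ k, minor Q₀ k (b k) ≠ 0 := fun k h => hb k (hzero k _ h)
  let a : ∀ k, ({j // j ≤ k} → Fin n) → ℝ := fun k f =>
    (minor Q k f / minor Q k (b k)) / (minor Q₀ k f / minor Q₀ k (b k))
  have ha : ∀ k f, minor Q₀ k f ≠ 0 → Tendsto (fun m =>
      Real.exp (∑ j, t m (f j) - ∑ j, t m (b k j))) atTop (𝓝 (a k f)) := by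
    intro k f hf
    refine (((hminor k f).div (hminor k (b k)) (hb k)).div_const _).congr fun m => ?_
    rw [Pi.div_apply, hrf, hrf, Real.exp_sub]
    have h1 := (hr m k).ne'
    have h2 := hb0 k
    have h3 := Real.exp_ne_zero (∑ j, t m (b k j))
    field_simp
  -- `A` indexes the surviving minors and `L` records their exponents relative to `b`. These
  -- converge along the sequence, to the logarithms of `a`.
  let A := {p : Σ k : Fin n, ({j // j ≤ k} → Fin n) // minor Q p.1 p.2 ≠ 0}
  let L : (Fin n → ℝ) →ₗ[ℝ] (A → ℝ) :=
    { toFun := fun v p => ∑ j, v (p.1.2 j) - ∑ j, v (b p.1.1 j)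
      map_add' := fun v w => by
        funext p
        simp only [Pi.add_apply, Finset.sum_add_distrib]
        ring
      map_smul' := fun s v => by
        funext p
        simp only [Pi.smul_apply, smul_eq_mul, ← Finset.mul_sum, RingHom.id_apply]
        ring }
  have hL : ∀ v k f, ∀ hf : minor Q k f ≠ 0, L v ⟨⟨k, f⟩, hf⟩ = ∑ j, v (f j) - ∑ j, v (b k j) :=
    fun v k f hf => rfl
  have hapos : ∀ k f, minor Q k f ≠ 0 → 0 < a k f := by
    intro k f hf
    have hf0 : minor Q₀ k f ≠ 0 := fun h => hf (hzero k f h)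
    refine lt_of_le_of_ne (ge_of_tendsto' (ha k f hf0) fun m => (Real.exp_pos _).le) ?_
    exact (div_ne_zero (div_ne_zero hf (hb k)) (div_ne_zero hf0 (hb0 k))).symm
  have hLlim : Tendsto (fun m => L (t m)) atTop (𝓝 fun p : A => Real.log (a p.1.1 p.1.2)) := by
    refine tendsto_pi_nhds.2 fun p => ?_
    have h1 := (ha p.1.1 p.1.2 (fun h => p.2 (hzero _ _ h))).log (hapos _ _ p.2).ne'
    simp only [Real.log_exp] at h1
    exact h1
  obtain ⟨τ, v, hv, hLv, hLτ⟩ := L.exists_tendsto_lift hLlim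
  -- For a minor that dies in the limit, the relative exponent tends to `-∞`, and still does so
  -- after subtracting the convergent `v m`. There are finitely many such minors, so a single `m`
  -- serves them all.
  have hev : ∀ᶠ m in atTop, ∀ k f, minor Q₀ k f ≠ 0 → minor Q k f = 0 →
      ∑ j, (t m - v m) (f j) < ∑ j, (t m - v m) (b k j) := by
    refine eventually_all.2 fun k => eventually_all.2 fun f => ?_
    by_cases hf0 : minor Q₀ k f ≠ 0
    swap
    · exact Eventually.of_forall fun m h => absurd h hf0
    by_cases hf : minor Q k f = 0
    swap
    · exact Eventually.of_forall fun m _ h => absurd h hf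
    have h1 : Tendsto (fun m => ∑ j, t m (f j) - ∑ j, t m (b k j)) atTop atBot := by
      rw [← Real.tendsto_exp_comp_nhds_zero]
      have h2 := ha k f hf0
      simpa only [a, hf, zero_div] using h2
    have h2 : Tendsto (fun m => ∑ j, v m (b k j) - ∑ j, v m (f j)) atTop
        (𝓝 (∑ j, τ (b k j) - ∑ j, τ (f j))) := by
      have h3 : ∀ i, Tendsto (fun m => v m i) atTop (𝓝 (τ i)) := tendsto_pi_nhds.1 hv
      exact (tendsto_finsetSum _ fun j _ => h3 _).sub (tendsto_finsetSum _ fun j _ => h3 _)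
    filter_upwards [(h1.atBot_add h2).eventually (eventually_lt_atBot 0)] with m hm _ _
    simp only [Pi.sub_apply, Finset.sum_sub_distrib]
    linarith
  obtain ⟨m, hm⟩ := hev.exists
  have hρ : ∀ k, 0 < minor Q k (b k) / minor Q₀ k (b k) := by
    intro k
    refine lt_of_le_of_ne (ge_of_tendsto' ((hminor k (b k)).div_const _) fun m => ?_)
      (div_ne_zero (hb k) (hb0 k)).symm
    rw [hrf, mul_div_cancel_right₀ _ (hb0 k)]
    exact (mul_pos (hr m k) (Real.exp_pos _)).le
  -- The direction is `t m - v m` at one large `m`. As `L (v m) = L (t m)`, its sums agree with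
  -- those on `b k` for the surviving rows, and they are strictly smaller for the dying ones.
  refine ⟨τ, t m - v m, fun k => minor Q k (b k) / minor Q₀ k (b k) /
    Real.exp (∑ j, τ (b k j)), fun k => ∑ j, (t m - v m) (b k j),
    fun k => div_pos (hρ k) (Real.exp_pos _), fun k f => ⟨hzero k f, fun hf0 => ?_⟩⟩
  by_cases hf : minor Q k f = 0
  · exact Or.inr ⟨hm k f hf0 hf, hf⟩
  · refine Or.inl ⟨?_, ?_⟩
    · have h1 := congrFun (hLv m) ⟨⟨k, f⟩, hf⟩
      rw [hL, hL] at h1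
      simp only [Pi.sub_apply, Finset.sum_sub_distrib]
      linarith
    · have h1 := congrArg Real.exp (congrFun hLτ ⟨⟨k, f⟩, hf⟩)
      rw [hL, Real.exp_log (hapos k f hf), Real.exp_sub] at h1
      have h2 := hb k
      have h3 := hb0 k
      have h4 := Real.exp_ne_zero (∑ j, τ (b k j))
      have h5 : Real.exp (∑ j, τ (f j)) = a k f * Real.exp (∑ j, τ (b k j)) := by
        rw [← h1]
        field_simp
      rw [h5]
      simp only [a]
      field_simp

end Closure

/-! ### Injectivity and supporting functionals of the moment map -/

/-- The vectors `v` along which the torus acts trivially on the orbit of `Q₀`. -/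
def stabilizerDirections {n : ℕ} (Q₀ : Matrix (Fin n) (Fin n) ℝ) : Submodule ℝ (Fin n → ℝ) where
  carrier := {v | ∀ k f g, minor Q₀ k f ≠ 0 → minor Q₀ k g ≠ 0 → ∑ j, v (f j) = ∑ j, v (g j)}
  add_mem' := fun {v w} hv hw k f g hf hg => by
    simp only [Pi.add_apply, Finset.sum_add_distrib, hv k f g hf hg, hw k f g hf hg]
  zero_mem' := fun k f g _ _ => by simp
  smul_mem' := fun s v hv k f g hf hg => by
    simp only [Pi.smul_apply, smul_eq_mul, ← Finset.mul_sum, hv k f g hf hg]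

section Moment

variable {n : ℕ} {lam : Fin n → ℝ} {Q₀ Q Q' : Matrix (Fin n) (Fin n) ℝ}

/-- For fixed `k` the squared minors have the same total for all orthogonal matrices, so any level
`h k` may be subtracted. It is chosen later so that every term has a sign. -/
theorem exists_moment_sub_pairing (hlam : StrictAnti lam) :
    ∃ W : Fin n → ℝ, (∀ k, 0 < W k) ∧
      ∀ Q Q' : Matrix (Fin n) (Fin n) ℝ, Qᵀ * Q = 1 → Q'ᵀ * Q' = 1 → ∀ v h : Fin n → ℝ,
        ∑ i, v i * moment lam Q i - ∑ i, v i * moment lam Q' i =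
          ∑ k, W k * ∑ f, (minor Q k f ^ 2 - minor Q' k f ^ 2) * (∑ j, v (f j) - h k) := by
  obtain ⟨c, W, hW, hp⟩ := exists_moment_pairing hlam
  refine ⟨W, hW, fun Q Q' hQ hQ' v h => ?_⟩
  rw [hp Q hQ, hp Q' hQ', add_sub_add_left_eq_sub, ← Finset.sum_sub_distrib]
  refine Finset.sum_congr rfl fun k _ => ?_
  rw [← mul_sub, ← Finset.sum_sub_distrib]
  congr 1
  have h1 : ∑ f, (minor Q k f ^ 2 - minor Q' k f ^ 2) * h k = 0 := by
    rw [← Finset.sum_mul, Finset.sum_sub_distrib, sum_minor_sq hQ, sum_minor_sq hQ', sub_self,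
      zero_mul]
  simp only [mul_sub, Finset.sum_sub_distrib, sub_mul] at h1 ⊢
  linarith

theorem minor_eq_zero_of_mem_closure (hQ : Q ∈ closure (qrOrbit Q₀)) {k : Fin n}
    {f : {j // j ≤ k} → Fin n} (h : minor Q₀ k f = 0) : minor Q k f = 0 := by
  obtain ⟨τ, u, ρ, h', hρ, hface⟩ := exists_face_of_mem_closure hQ
  exact (hface k f).1 h

/-- Pair the difference of the moments with the face direction `u` of `Q`: all terms are nonnegative
and their sum is zero, so the minors of `Q'` vanish off the face of `Q`. -/
theorem minor_eq_zero_of_moment_eq (hlam : StrictAnti lam) (hQ : Q ∈ closure (qrOrbit Q₀))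
    (hQ' : Q' ∈ closure (qrOrbit Q₀)) (h : moment lam Q = moment lam Q') {k : Fin n}
    {f : {j // j ≤ k} → Fin n} (hf : minor Q k f = 0) : minor Q' k f = 0 := by
  obtain ⟨W, hW, hp⟩ := exists_moment_sub_pairing hlam
  obtain ⟨τ, u, ρ, h', hρ, hface⟩ := exists_face_of_mem_closure hQ
  have h1 := hp Q Q' (transpose_mul_self_of_mem (closure_qrOrbit_subset hQ))
    (transpose_mul_self_of_mem (closure_qrOrbit_subset hQ')) u h'
  rw [h, sub_self] at h1
  have hterm : ∀ k f, 0 ≤ (minor Q k f ^ 2 - minor Q' k f ^ 2) * (∑ j, u (f j) - h' k) := by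
    intro k f
    by_cases h0 : minor Q₀ k f = 0
    · rw [minor_eq_zero_of_mem_closure hQ h0, minor_eq_zero_of_mem_closure hQ' h0]
      simp
    · rcases (hface k f).2 h0 with ⟨h2, -⟩ | ⟨h2, h3⟩
      · rw [h2, sub_self, mul_zero]
      · rw [h3]
        nlinarith [sq_nonneg (minor Q' k f)]
  have h2 := (Finset.sum_eq_zero_iff_of_nonneg (fun k _ => mul_nonneg (hW k).le
    (Finset.sum_nonneg fun f _ => hterm k f))).1 h1.symm k (Finset.mem_univ _)
  have h3 := (Finset.sum_eq_zero_iff_of_nonneg (fun f _ => hterm k f)).1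
    ((mul_eq_zero.1 h2).resolve_left (hW k).ne') f (Finset.mem_univ _)
  by_cases h0 : minor Q₀ k f = 0
  · exact minor_eq_zero_of_mem_closure hQ' h0
  · rcases (hface k f).2 h0 with ⟨-, h4⟩ | ⟨h4, -⟩
    · exact absurd (h4.symm.trans hf)
        (mul_ne_zero (mul_pos (hρ k) (Real.exp_pos _)).ne' h0)
    · rw [hf] at h3
      rcases mul_eq_zero.1 h3 with h5 | h5
      · nlinarith [sq_nonneg (minor Q' k f)]
      · linarith

/-- Both matrices have the same surviving minors, and on these they differ by factors `exp x` with
`x = ∑ j, (τ - τ') (f j) - h k` for a suitable level `h`. Pairing with `τ - τ'` gives terms `y ^ 2 *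
(exp x ^ 2 - 1) * x ≥ 0` with sum zero, hence `x = 0` wherever the minor `y` of `Q'` is nonzero. -/
theorem moment_injOn (hlam : StrictAnti lam) :
    Set.InjOn (moment lam) (closure (qrOrbit Q₀)) := by
  intro Q hQ Q' hQ' h
  have hO := transpose_mul_self_of_mem (closure_qrOrbit_subset hQ)
  have hO' := transpose_mul_self_of_mem (closure_qrOrbit_subset hQ')
  obtain ⟨W, hW, hp⟩ := exists_moment_sub_pairing hlam
  obtain ⟨τ, u, ρ, h₁, hρ, hface⟩ := exists_face_of_mem_closure hQ
  obtain ⟨τ', u', ρ', h₁', hρ', hface'⟩ := exists_face_of_mem_closure hQ'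
  have h1 := hp Q Q' hO hO' (τ - τ') fun k => Real.log (ρ' k) - Real.log (ρ k)
  rw [h, sub_self] at h1
  have hrel : ∀ k f, minor Q k f ≠ 0 → minor Q k f = Real.exp (∑ j, (τ - τ') (f j) -
      (Real.log (ρ' k) - Real.log (ρ k))) * minor Q' k f := by
    intro k f hf
    have h0 : minor Q₀ k f ≠ 0 := fun h => hf (minor_eq_zero_of_mem_closure hQ h)
    have hf' : minor Q' k f ≠ 0 := fun h2 => hf (minor_eq_zero_of_moment_eq hlam hQ' hQ h.symm h2)
    have e1 := ((hface k f).2 h0).resolve_right (fun h => hf h.2)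
    have e2 := ((hface' k f).2 h0).resolve_right (fun h => hf' h.2)
    rw [e1.2, e2.2]
    simp only [Pi.sub_apply, Finset.sum_sub_distrib]
    rw [Real.exp_sub, Real.exp_sub, Real.exp_sub, Real.exp_log (hρ k), Real.exp_log (hρ' k)]
    have a1 := (hρ k).ne'
    have a2 := (hρ' k).ne'
    field_simp
  have hsq : ∀ x y : ℝ, 0 ≤ ((Real.exp x * y) ^ 2 - y ^ 2) * x ∧
      (((Real.exp x * y) ^ 2 - y ^ 2) * x = 0 → y ≠ 0 → x = 0) := by
    intro x y
    have e : ((Real.exp x * y) ^ 2 - y ^ 2) * x = y ^ 2 * ((Real.exp x + 1) *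
        ((Real.exp x - 1) * x)) := by ring
    have hp := Real.exp_pos x
    rw [e]
    rcases lt_trichotomy x 0 with hx | rfl | hx
    · have h2 : 0 < (Real.exp x - 1) * x :=
        mul_pos_of_neg_of_neg (by linarith [Real.exp_lt_exp.2 hx, Real.exp_zero]) hx
      refine ⟨by positivity, fun h3 hy => absurd h3 (by positivity)⟩
    · simp
    · have h2 : 0 < (Real.exp x - 1) * x :=
        mul_pos (by linarith [Real.one_lt_exp_iff.2 hx]) hx
      refine ⟨by positivity, fun h3 hy => absurd h3 (by positivity)⟩
  have hterm : ∀ k f, 0 ≤ (minor Q k f ^ 2 - minor Q' k f ^ 2) *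
      (∑ j, (τ - τ') (f j) - (Real.log (ρ' k) - Real.log (ρ k))) := by
    intro k f
    by_cases hf : minor Q k f = 0
    · rw [hf, minor_eq_zero_of_moment_eq hlam hQ hQ' h hf]
      simp
    · rw [hrel k f hf]
      exact (hsq _ _).1
  refine eq_of_minor_eq hO hO' fun k => ⟨1, one_pos, fun f => ?_⟩
  rw [one_mul]
  by_cases hf : minor Q k f = 0
  · rw [hf, minor_eq_zero_of_moment_eq hlam hQ hQ' h hf]
  have h2 := (Finset.sum_eq_zero_iff_of_nonneg (fun k _ => mul_nonneg (hW k).le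
    (Finset.sum_nonneg fun f _ => hterm k f))).1 h1.symm k (Finset.mem_univ _)
  have h3 := (Finset.sum_eq_zero_iff_of_nonneg (fun f _ => hterm k f)).1
    ((mul_eq_zero.1 h2).resolve_left (hW k).ne') f (Finset.mem_univ _)
  have hf' : minor Q' k f ≠ 0 := fun h2 => hf (minor_eq_zero_of_moment_eq hlam hQ' hQ h.symm h2)
  rw [hrel k f hf] at h3 ⊢
  rw [(hsq _ _).2 h3 hf', Real.exp_zero, one_mul]

theorem minor_ne_zero_of_mem (hQ : Q ∈ qrOrbit Q₀) {k : Fin n} {f : {j // j ≤ k} → Fin n}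
    (h : minor Q₀ k f ≠ 0) : minor Q k f ≠ 0 := by
  obtain ⟨-, t, R, hR, hQR⟩ := hQ
  obtain ⟨ρ, hρ⟩ := exists_minor_eq_of_mul_eq hR hQR
  rw [(hρ k).2 f]
  exact mul_ne_zero (mul_pos (hρ k).1 (Real.exp_pos _)).ne' h

/-- The moment of a boundary point is exposed by a functional which is not maximal on the orbit. -/
theorem exists_supporting_functional (hlam : StrictAnti lam)
    (h₀ : Q₀ ∈ Matrix.specialOrthogonalGroup (Fin n) ℝ)
    (hQ : Q ∈ closure (qrOrbit Q₀)) (hQn : Q ∉ qrOrbit Q₀) :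
    ∃ u : Fin n → ℝ, (∀ Q' ∈ closure (qrOrbit Q₀),
      ∑ i, u i * moment lam Q' i ≤ ∑ i, u i * moment lam Q i) ∧
      ∀ Q' ∈ qrOrbit Q₀, ∑ i, u i * moment lam Q' i < ∑ i, u i * moment lam Q i := by
  have hO := transpose_mul_self_of_mem (closure_qrOrbit_subset hQ)
  obtain ⟨W, hW, hp⟩ := exists_moment_sub_pairing hlam
  obtain ⟨τ, u, ρ, h, hρ, hface⟩ := exists_face_of_mem_closure hQ
  have hterm : ∀ Q' ∈ closure (qrOrbit Q₀), ∀ k f,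
      0 ≤ (minor Q k f ^ 2 - minor Q' k f ^ 2) * (∑ j, u (f j) - h k) := by
    intro Q' hQ' k f
    by_cases h0 : minor Q₀ k f = 0
    · rw [minor_eq_zero_of_mem_closure hQ h0, minor_eq_zero_of_mem_closure hQ' h0]
      simp
    · rcases (hface k f).2 h0 with ⟨h2, -⟩ | ⟨h2, h3⟩
      · rw [h2, sub_self, mul_zero]
      · rw [h3]
        nlinarith [sq_nonneg (minor Q' k f)]
  refine ⟨u, fun Q' hQ' => ?_, fun Q' hQ' => ?_⟩
  · have h1 := hp Q Q' hO (transpose_mul_self_of_mem (closure_qrOrbit_subset hQ')) u h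
    have h2 : 0 ≤ ∑ i, u i * moment lam Q i - ∑ i, u i * moment lam Q' i := by
      rw [h1]
      exact Finset.sum_nonneg fun k _ => mul_nonneg (hW k).le
        (Finset.sum_nonneg fun f _ => hterm Q' hQ' k f)
    linarith
  · have hQ'c := subset_closure hQ'
    have h1 := hp Q Q' hO (transpose_mul_self_of_mem (closure_qrOrbit_subset hQ'c)) u h
    -- If no minor died, the face would be everything and `Q` would have the Plücker coordinates of
    -- the orbit point `N τ`, up to positive scalars.
    have hex : ∃ k f, minor Q₀ k f ≠ 0 ∧ ∑ j, u (f j) < h k ∧ minor Q k f = 0 := by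
      by_contra! hcon
      refine hQn ?_
      obtain ⟨N, -, hN⟩ := exists_qrOrbit_param h₀
      obtain ⟨hNO, R, hR, hNR⟩ := hN τ
      obtain ⟨r, hr⟩ := exists_minor_eq_of_mul_eq hR hNR
      have : Q = N τ := by
        refine eq_of_minor_eq hO (transpose_mul_self_of_mem hNO) fun k =>
          ⟨ρ k / r k, div_pos (hρ k) (hr k).1, fun f => ?_⟩
        have hrk := (hr k).1.ne'
        by_cases h0 : minor Q₀ k f = 0
        · rw [(hr k).2 f, h0, (hface k f).1 h0]
          simp
        · have h3 := ((hface k f).2 h0).resolve_right fun h4 => hcon k f h0 h4.1 h4.2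
          rw [h3.2, (hr k).2 f]
          field_simp
      rw [this]
      exact ⟨hNO, τ, R, hR, hNR⟩
    obtain ⟨k, f, h0, h2, h3⟩ := hex
    have hpos : 0 < (minor Q k f ^ 2 - minor Q' k f ^ 2) * (∑ j, u (f j) - h k) := by
      have := minor_ne_zero_of_mem hQ' h0
      have h4 : 0 < minor Q' k f ^ 2 := by positivity
      rw [h3]
      nlinarith
    have h5 : 0 < ∑ i, u i * moment lam Q i - ∑ i, u i * moment lam Q' i := by
      rw [h1]
      refine Finset.sum_pos' (fun k _ => mul_nonneg (hW k).le
        (Finset.sum_nonneg fun f _ => hterm Q' hQ'c k f)) ⟨k, Finset.mem_univ _, ?_⟩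
      exact mul_pos (hW k) (Finset.sum_pos' (fun f _ => hterm Q' hQ'c k f)
        ⟨f, Finset.mem_univ _, hpos⟩)
    linarith

/-- For a stabilizer direction all supported rows have the same weight, and subtracting it kills
every term. So the image of the closure lies in an affine subspace. -/
theorem sum_mul_moment_eq_of_mem (hlam : StrictAnti lam) {v : Fin n → ℝ}
    (hv : v ∈ stabilizerDirections Q₀)
    (hQ : Q ∈ closure (qrOrbit Q₀)) (hQ' : Q' ∈ closure (qrOrbit Q₀)) :
    ∑ i, v i * moment lam Q i = ∑ i, v i * moment lam Q' i := by
  obtain ⟨W, hW, hp⟩ := exists_moment_sub_pairing hlam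
  have hO := transpose_mul_self_of_mem (closure_qrOrbit_subset hQ)
  choose b hb using exists_minor_ne_zero hO
  have hb0 : ∀ k, minor Q₀ k (b k) ≠ 0 := fun k h => hb k (minor_eq_zero_of_mem_closure hQ h)
  rw [← sub_eq_zero, hp Q Q' hO (transpose_mul_self_of_mem (closure_qrOrbit_subset hQ')) v
    fun k => ∑ j, v (b k j)]
  refine Finset.sum_eq_zero fun k _ => mul_eq_zero_of_right _ (Finset.sum_eq_zero fun f _ => ?_)
  by_cases h0 : minor Q₀ k f = 0
  · rw [minor_eq_zero_of_mem_closure hQ h0, minor_eq_zero_of_mem_closure hQ' h0]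
    simp
  · rw [hv k f (b k) h0 (hb0 k), sub_self, mul_zero]

theorem mem_qrOrbit_self (h₀ : Q₀ ∈ Matrix.specialOrthogonalGroup (Fin n) ℝ) :
    Q₀ ∈ qrOrbit Q₀ :=
  ⟨h₀, 0, 1, ⟨Matrix.blockTriangular_one, fun i => by simp⟩, by simp⟩

/-- Follow the torus along multiples of `u` and take a limit by compactness. A minor with a heavier
competitor decays exponentially relative to it, and the competitor stays bounded. -/
theorem exists_mem_closure_supported_on_face
    (h₀ : Q₀ ∈ Matrix.specialOrthogonalGroup (Fin n) ℝ) (u : Fin n → ℝ) :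
    ∃ Q ∈ closure (qrOrbit Q₀), ∀ k f, minor Q k f ≠ 0 → ∀ g, minor Q₀ k g ≠ 0 →
      ∑ j, u (g j) ≤ ∑ j, u (f j) := by
  obtain ⟨N, -, hN⟩ := exists_qrOrbit_param h₀
  have hmem : ∀ m : ℕ, N ((m : ℝ) • u) ∈ closure (qrOrbit Q₀) := fun m =>
    subset_closure ⟨(hN _).1, _, (hN _).2⟩
  have : FirstCountableTopology (Matrix (Fin n) (Fin n) ℝ) :=
    inferInstanceAs (FirstCountableTopology (Fin n → Fin n → ℝ))
  obtain ⟨Q, hQ, φ, hφ, hlim⟩ := isCompact_closure_qrOrbit.tendsto_subseq hmem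
  refine ⟨Q, hQ, fun k f hf g hg => ?_⟩
  by_contra! hlt
  refine hf ?_
  set C : ℝ := ((Fintype.card {j // j ≤ k}).factorial : ℝ) with hC
  have hbound : ∀ m : ℕ, minor (N ((m : ℝ) • u)) k f ^ 2 ≤
      C * (minor Q₀ k f / minor Q₀ k g) ^ 2 *
        Real.exp (2 * (∑ j, u (f j) - ∑ j, u (g j)) * m) := by
    intro m
    obtain ⟨hNO, R, hR, hNR⟩ := hN ((m : ℝ) • u)
    obtain ⟨r, hr⟩ := exists_minor_eq_of_mul_eq hR hNR
    have h1 : minor (N ((m : ℝ) • u)) k g ^ 2 ≤ C := by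
      rw [hC, ← sum_minor_sq (transpose_mul_self_of_mem hNO) k]
      exact Finset.single_le_sum (f := fun g => minor (N ((m : ℝ) • u)) k g ^ 2)
        (fun g _ => sq_nonneg _) (Finset.mem_univ g)
    have h2 : minor (N ((m : ℝ) • u)) k f ^ 2 = minor (N ((m : ℝ) • u)) k g ^ 2 *
        ((minor Q₀ k f / minor Q₀ k g) ^ 2 *
          Real.exp (2 * (∑ j, u (f j) - ∑ j, u (g j)) * m)) := by
      have h3 : Real.exp (2 * (∑ j, u (f j) - ∑ j, u (g j)) * m) =
          (Real.exp (∑ j, ((m : ℝ) • u) (f j)) / Real.exp (∑ j, ((m : ℝ) • u) (g j))) ^ 2 := by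
        rw [← Real.exp_sub, sq, ← Real.exp_add]
        congr 1
        simp only [Pi.smul_apply, smul_eq_mul, ← Finset.mul_sum]
        ring
      rw [(hr k).2 f, (hr k).2 g, h3]
      have := (hr k).1.ne'
      field_simp
    rw [h2, mul_assoc C]
    exact mul_le_mul_of_nonneg_right h1 (mul_nonneg (sq_nonneg _) (Real.exp_pos _).le)
  have hlim1 : Tendsto (fun m => minor (N ((φ m : ℝ) • u)) k f ^ 2) atTop
      (𝓝 (minor Q k f ^ 2)) :=
    (((continuous_minor k f).tendsto Q).comp hlim).pow 2
  have hlim2 : Tendsto (fun m : ℕ => C * (minor Q₀ k f / minor Q₀ k g) ^ 2 *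
      Real.exp (2 * (∑ j, u (f j) - ∑ j, u (g j)) * φ m)) atTop (𝓝 0) := by
    have h1 : Tendsto (fun m : ℕ => 2 * (∑ j, u (f j) - ∑ j, u (g j)) * (φ m : ℝ)) atTop
        atBot :=
      (tendsto_natCast_atTop_atTop.comp hφ.tendsto_atTop).const_mul_atTop_of_neg
        (by linarith)
    simpa using (Real.tendsto_exp_atBot.comp h1).const_mul
      (C * (minor Q₀ k f / minor Q₀ k g) ^ 2)
  have h3 : minor Q k f ^ 2 ≤ 0 := le_of_tendsto_of_tendsto' hlim1 hlim2 fun m => hbound (φ m)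
  nlinarith

theorem sum_mul_moment_le_of_supported (hlam : StrictAnti lam) {u : Fin n → ℝ}
    (hQ : Q ∈ closure (qrOrbit Q₀)) (hQ' : Q' ∈ closure (qrOrbit Q₀))
    (hu : ∀ k f, minor Q k f ≠ 0 → ∀ g, minor Q₀ k g ≠ 0 → ∑ j, u (g j) ≤ ∑ j, u (f j)) :
    ∑ i, u i * moment lam Q' i ≤ ∑ i, u i * moment lam Q i := by
  obtain ⟨W, hW, hp⟩ := exists_moment_sub_pairing hlam
  have hO := transpose_mul_self_of_mem (closure_qrOrbit_subset hQ)
  choose b hb using exists_minor_ne_zero hO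
  have h1 := hp Q Q' hO (transpose_mul_self_of_mem (closure_qrOrbit_subset hQ')) u
    fun k => ∑ j, u (b k j)
  have h2 : 0 ≤ ∑ i, u i * moment lam Q i - ∑ i, u i * moment lam Q' i := by
    rw [h1]
    refine Finset.sum_nonneg fun k _ => mul_nonneg (hW k).le (Finset.sum_nonneg fun f _ => ?_)
    by_cases h0 : minor Q₀ k f = 0
    · rw [minor_eq_zero_of_mem_closure hQ h0, minor_eq_zero_of_mem_closure hQ' h0]
      simp
    · have h3 := hu k (b k) (hb k) f h0
      by_cases hf : minor Q k f = 0
      · rw [hf]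
        nlinarith [sq_nonneg (minor Q' k f)]
      · have h4 := hu k f hf (b k) fun h => hb k (minor_eq_zero_of_mem_closure hQ h)
        rw [le_antisymm h3 h4, sub_self, mul_zero]
  linarith

end Moment

/-! ### Generic functionals and vertices -/

/-- The vectors `u` separating maps with distinct images of the same size. -/
def IsGeneric {n : ℕ} (u : Fin n → ℝ) : Prop :=
  ∀ (k : Fin n) (f g : {j // j ≤ k} → Fin n), Function.Injective f → Function.Injective g →
    ∑ j, u (f j) = ∑ j, u (g j) → Set.range f = Set.range g

theorem isGeneric_two_pow (n : ℕ) : IsGeneric fun i : Fin n => (2 : ℝ) ^ (i : ℕ) := by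
  intro k f g hf hg h
  have hsum : ∀ f : {j // j ≤ k} → Fin n, Function.Injective f →
      ∑ j, (2 : ℝ) ^ (f j : ℕ) =
        ((∑ i ∈ Finset.univ.image fun j => (f j : ℕ), 2 ^ i : ℕ) : ℝ) := by
    intro f hf
    rw [Finset.sum_image fun a _ b _ hab => hf (Fin.ext hab)]
    push_cast
    rfl
  rw [hsum f hf, hsum g hg] at h
  have h1 := Finset.geomSum_injective (le_refl 2) (Nat.cast_injective h)
  ext i
  have h2 : ∀ f : {j // j ≤ k} → Fin n, i ∈ Set.range f ↔
      (i : ℕ) ∈ Finset.univ.image fun j => (f j : ℕ) := fun f => by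
    simp [Fin.val_inj]
  rw [h2, h2, h1]

/-- Powers of two separate sets of rows by uniqueness of binary expansions. Hence each pair of maps
with distinct images excludes at most one `ε`. -/
theorem eventually_isGeneric {n : ℕ} (u : Fin n → ℝ) :
    ∀ᶠ ε in 𝓝[≠] (0 : ℝ), IsGeneric fun i => u i + ε * 2 ^ (i : ℕ) := by
  let bad : (Σ k : Fin n, ({j // j ≤ k} → Fin n) × ({j // j ≤ k} → Fin n)) → ℝ := fun p =>
    (∑ j, u (p.2.2 j) - ∑ j, u (p.2.1 j)) /
      (∑ j, (2 : ℝ) ^ (p.2.1 j : ℕ) - ∑ j, (2 : ℝ) ^ (p.2.2 j : ℕ))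
  -- Zero is discarded because `u` itself may fail to be generic, and because division by zero sends
  -- some irrelevant pairs there.
  have hfin : (Set.range bad \ {0}).Finite := (Set.finite_range bad).sdiff
  have hev : ∀ᶠ ε in 𝓝 (0 : ℝ), ε ∉ Set.range bad \ {0} :=
    hfin.isClosed.isOpen_compl.mem_nhds (by simp)
  filter_upwards [hev.filter_mono nhdsWithin_le_nhds, self_mem_nhdsWithin] with ε h1 h2
  intro k f g hf hg h
  by_contra hne
  have h3 : ∑ j, (2 : ℝ) ^ (f j : ℕ) - ∑ j, (2 : ℝ) ^ (g j : ℕ) ≠ 0 := fun h3 =>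
    hne (isGeneric_two_pow n k f g hf hg (sub_eq_zero.1 h3))
  refine h1 ⟨⟨⟨k, f, g⟩, ?_⟩, h2⟩
  simp only [Finset.sum_add_distrib, ← Finset.mul_sum] at h
  rw [div_eq_iff h3]
  linarith

section Vertices

variable {n : ℕ} {lam : Fin n → ℝ} {Q₀ Q Q' : Matrix (Fin n) (Fin n) ℝ}

theorem sum_row_sq (hQ : Qᵀ * Q = 1) (i : Fin n) : ∑ j, Q i j ^ 2 = 1 := by
  have hQ1 : Q * Qᵀ = 1 := mul_eq_one_comm.1 hQ
  have h1 := congrFun (congrFun hQ1 i) i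
  rw [Matrix.mul_apply, Matrix.one_apply_eq] at h1
  rw [← h1]
  exact Finset.sum_congr rfl fun j _ => by rw [Matrix.transpose_apply, sq]

/-- If the supports of the Plücker vectors of `Q` have a single image, each row of `Q` has a single
nonzero entry. -/
theorem mul_eq_zero_of_range_eq (hQ : Qᵀ * Q = 1)
    (h : ∀ k f g, minor Q k f ≠ 0 → minor Q k g ≠ 0 → Set.range f = Set.range g)
    (i a b : Fin n) (hab : a < b) : Q i a * Q i b = 0 := by
  -- Apply the first moment formula to the indicator of row `i`: as all surviving minors use the
  -- same rows, the mass of row `i` in the columns up to `a` is `1` or `0`. If `Q i a ≠ 0` it is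
  -- `1`, and nothing is left for column `b`.
  have hsum : ∑ j : {j // j ≤ a}, Q i j ^ 2 = 0 ∨ ∑ j : {j // j ≤ a}, Q i j ^ 2 = 1 := by
    obtain ⟨f₀, hf₀⟩ := exists_minor_ne_zero hQ a
    have hinj : ∀ f, minor Q a f ≠ 0 → Function.Injective f := fun f hf =>
      not_imp_comm.1 (minor_eq_zero_of_not_injective Q a f) hf
    have hcount : ∀ f, minor Q a f ≠ 0 → ∑ j, (Pi.single i (1 : ℝ) : Fin n → ℝ) (f j) =
        if i ∈ Set.range f₀ then 1 else 0 := by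
      intro f hf
      simp only [← h a f f₀ hf hf₀]
      split_ifs with hi
      · obtain ⟨j, rfl⟩ := hi
        rw [Finset.sum_eq_single j]
        · simp
        · intro l _ hl
          exact Pi.single_eq_of_ne (fun e => hl (hinj f hf e)) _
        · simp
      · exact Finset.sum_eq_zero fun j _ => Pi.single_eq_of_ne (fun e => hi ⟨j, e⟩) _
    have h1 := sum_minor_sq_mul hQ a (Pi.single i 1)
    have h2 : ∑ f, minor Q a f ^ 2 * ∑ j, (Pi.single i (1 : ℝ) : Fin n → ℝ) (f j) =
        ∑ f, minor Q a f ^ 2 * if i ∈ Set.range f₀ then 1 else 0 := by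
      refine Finset.sum_congr rfl fun f _ => ?_
      by_cases hf : minor Q a f = 0
      · rw [hf]
        simp
      · rw [hcount f hf]
    have h3 : ∑ l, (Pi.single i (1 : ℝ) : Fin n → ℝ) l * ∑ j : {j // j ≤ a}, Q l j ^ 2 =
        ∑ j : {j // j ≤ a}, Q i j ^ 2 := by
      rw [Finset.sum_eq_single i]
      · simp
      · intro l _ hl
        rw [Pi.single_eq_of_ne hl, zero_mul]
      · simp
    rw [h2, h3, ← Finset.sum_mul, sum_minor_sq hQ] at h1
    have h4 : ((Fintype.card {j // j ≤ a}).factorial : ℝ) ≠ 0 := by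
      exact_mod_cast Nat.factorial_ne_zero _
    have h5 := mul_left_cancel₀ h4 h1
    split_ifs at h5
    · exact Or.inr h5.symm
    · exact Or.inl h5.symm
  by_cases ha : Q i a = 0
  · rw [ha, zero_mul]
  have hpos : 0 < Q i a ^ 2 := by positivity
  have hle : Q i a ^ 2 ≤ ∑ j : {j // j ≤ a}, Q i j ^ 2 :=
    Finset.single_le_sum (f := fun j : {j // j ≤ a} => Q i j ^ 2) (fun j _ => sq_nonneg _)
      (Finset.mem_univ ⟨a, le_rfl⟩)
  have hone : ∑ j : {j // j ≤ a}, Q i j ^ 2 = 1 := hsum.resolve_left fun h => by linarith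
  have hsub : ∑ j : {j // j ≤ a}, Q i j ^ 2 = ∑ j ∈ Finset.Iic a, Q i j ^ 2 :=
    (Finset.sum_subtype (Finset.Iic a) (fun l => by simp) fun l => Q i l ^ 2).symm
  have htot : ∑ j ∈ Finset.Iic a, Q i j ^ 2 + Q i b ^ 2 ≤ ∑ j, Q i j ^ 2 := by
    rw [add_comm, ← Finset.sum_insert (f := fun j => Q i j ^ 2)
      (show b ∉ Finset.Iic a by simpa using hab)]
    exact Finset.sum_le_sum_of_subset_of_nonneg (Finset.subset_univ _) fun j _ _ => sq_nonneg _
  rw [sum_row_sq hQ, ← hsub, hone] at htot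
  have hb : Q i b = 0 := by nlinarith [sq_nonneg (Q i b)]
  rw [hb, mul_zero]

/-- The orthogonal matrices whose rows are supported on one entry. -/
def IsMonomial (Q : Matrix (Fin n) (Fin n) ℝ) : Prop :=
  ∀ i a b, a ≠ b → Q i a * Q i b = 0

theorem IsMonomial.isDiag (h : IsMonomial Q) (lam : Fin n → ℝ) :
    (Qᵀ * Matrix.diagonal lam * Q).IsDiag := by
  intro a b hab
  rw [Matrix.mul_apply]
  refine Finset.sum_eq_zero fun i _ => ?_
  rw [Matrix.mul_diagonal, Matrix.transpose_apply, mul_right_comm, h i a b hab, zero_mul]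

theorem IsMonomial.moment_mem_range (h : IsMonomial Q) (hQ : Qᵀ * Q = 1) (i : Fin n) :
    moment lam Q i ∈ Set.range lam := by
  have h1 := sum_row_sq hQ i
  obtain ⟨a, ha⟩ : ∃ a, Q i a ≠ 0 := by
    by_contra! hcon
    simp [hcon] at h1
  have h2 : ∀ b, b ≠ a → Q i b = 0 := fun b hb =>
    (mul_eq_zero.1 (h i a b hb.symm)).resolve_left ha
  refine ⟨a, ?_⟩
  rw [Finset.sum_eq_single a (fun b _ hb => by rw [h2 b hb]; simp) (by simp)] at h1
  rw [moment, Finset.sum_eq_single a (fun b _ hb => by rw [h2 b hb]; simp) (by simp), h1, mul_one]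

/-- The limit of the flow along a generic `u` keeps, for each `k`, the minors on a single set of
rows, and this forces it to be monomial. -/
theorem exists_isMonomial_maximizer (hlam : StrictAnti lam)
    (h₀ : Q₀ ∈ Matrix.specialOrthogonalGroup (Fin n) ℝ) {u : Fin n → ℝ} (hu : IsGeneric u) :
    ∃ Q ∈ closure (qrOrbit Q₀), IsMonomial Q ∧ ∀ Q' ∈ closure (qrOrbit Q₀),
      ∑ i, u i * moment lam Q' i ≤ ∑ i, u i * moment lam Q i := by
  obtain ⟨Q, hQ, hface⟩ := exists_mem_closure_supported_on_face h₀ u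
  have hO := transpose_mul_self_of_mem (closure_qrOrbit_subset hQ)
  have hmon := mul_eq_zero_of_range_eq hO fun k f g hf hg => by
    have hf0 : minor Q₀ k f ≠ 0 := fun h => hf (minor_eq_zero_of_mem_closure hQ h)
    have hg0 : minor Q₀ k g ≠ 0 := fun h => hg (minor_eq_zero_of_mem_closure hQ h)
    exact hu k f g (not_imp_comm.1 (minor_eq_zero_of_not_injective Q k f) hf)
      (not_imp_comm.1 (minor_eq_zero_of_not_injective Q k g) hg)
      (le_antisymm (hface k g hg f hf0) (hface k f hf g hg0))
  refine ⟨Q, hQ, fun i a b hab => ?_, fun Q' hQ' =>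
    sum_mul_moment_le_of_supported hlam hQ hQ' hface⟩
  rcases lt_or_gt_of_ne hab with h | h
  · exact hmon i a b h
  · rw [mul_comm]
    exact hmon i b a h

/-- A point outside the hull would be strictly separated from it. The vertices being finite in
number, separation survives a small perturbation to a generic functional, whose maximum over the
closure is nevertheless attained at a vertex. -/
theorem moment_mem_convexHull (hlam : StrictAnti lam)
    (h₀ : Q₀ ∈ Matrix.specialOrthogonalGroup (Fin n) ℝ) (hQ : Q ∈ closure (qrOrbit Q₀)) :
    moment lam Q ∈ convexHull ℝ (moment lam '' {Q | Q ∈ closure (qrOrbit Q₀) ∧ IsMonomial Q}) := by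
  set V := moment lam '' {Q | Q ∈ closure (qrOrbit Q₀) ∧ IsMonomial Q} with hV
  have hfin : V.Finite := by
    refine (Set.Finite.pi' fun _ : Fin n => Set.finite_range lam).subset ?_
    rintro _ ⟨Q, ⟨hQ, hm⟩, rfl⟩ i
    exact hm.moment_mem_range (transpose_mul_self_of_mem (closure_qrOrbit_subset hQ)) i
  by_contra hnot
  obtain ⟨φ, s, hs, hsx⟩ := geometric_hahn_banach_closed_point (convex_convexHull ℝ V)
    (hfin.isClosed_convexHull ℝ) hnot
  set u : Fin n → ℝ := fun i => φ (Pi.single i 1) with hu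
  have hφ : ∀ x : Fin n → ℝ, φ x = ∑ i, u i * x i := by
    intro x
    conv_lhs => rw [pi_eq_sum_univ' x]
    rw [map_sum]
    refine Finset.sum_congr rfl fun i _ => ?_
    rw [map_smul, smul_eq_mul, mul_comm]
  have hev : ∀ᶠ ε in 𝓝 (0 : ℝ), ∀ y ∈ V, ∑ i, (u i + ε * 2 ^ (i : ℕ)) * y i <
      ∑ i, (u i + ε * 2 ^ (i : ℕ)) * moment lam Q i := by
    refine (Set.Finite.eventually_all hfin).2 fun y hy => ?_
    have hc : ∀ y : Fin n → ℝ, ContinuousAt (fun ε : ℝ => ∑ i, (u i + ε * 2 ^ (i : ℕ)) * y i) 0 :=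
      fun y => by fun_prop
    refine (hc y).eventually_lt (hc _) ?_
    have h1 := (hs y (subset_convexHull ℝ V hy)).trans hsx
    rw [hφ, hφ] at h1
    simpa using h1
  obtain ⟨ε, hε, hgen⟩ :=
    ((hev.filter_mono (nhdsWithin_le_nhds (s := {0}ᶜ))).and (eventually_isGeneric u)).exists
  obtain ⟨Q', hQ', hm, hmax⟩ := exists_isMonomial_maximizer hlam h₀ hgen
  exact absurd (hmax Q hQ) (not_le.2 (hε _ ⟨Q', ⟨hQ', hm⟩, rfl⟩))

end Vertices

/-! ### Local smooth sections of the moment map -/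

theorem ContDiff.exists_local_right_inverse {E : Type*} [NormedAddCommGroup E] [NormedSpace ℝ E]
    [FiniteDimensional ℝ E] {Ψ : E → E} (hΨ : ContDiff ℝ ∞ Ψ)
    (hinj : ∀ t v, fderiv ℝ Ψ t v = 0 → v = 0) (t₀ : E) :
    ∃ U : Set E, IsOpen U ∧ Ψ t₀ ∈ U ∧ ∃ g : E → E, ContDiffOn ℝ ∞ g U ∧ ∀ ξ ∈ U, Ψ (g ξ) = ξ := by
  have hcomplete : CompleteSpace E := FiniteDimensional.complete ℝ E
  have hker : ∀ t, LinearMap.ker (fderiv ℝ Ψ t : E →ₗ[ℝ] E) = ⊥ := fun t =>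
    LinearMap.ker_eq_bot'.2 fun v hv => hinj t v hv
  let e : ∀ _t : E, E ≃L[ℝ] E := fun t =>
    (LinearEquiv.ofInjectiveEndo (fderiv ℝ Ψ t : E →ₗ[ℝ] E)
      (LinearMap.ker_eq_bot.1 (hker t))).toContinuousLinearEquiv
  have he : ∀ t, HasFDerivAt Ψ (e t : E →L[ℝ] E) t := fun t => by
    have h1 : (e t : E →L[ℝ] E) = fderiv ℝ Ψ t := by
      ext v
      rfl
    rw [h1]
    exact (hΨ.differentiable (by simp) t).hasFDerivAt
  have hn : (∞ : WithTop ℕ∞) ≠ 0 := by simp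
  let Φ := (hΨ.contDiffAt (x := t₀)).toOpenPartialHomeomorph Ψ (he t₀) hn
  refine ⟨Φ.target, Φ.open_target,
    (hΨ.contDiffAt (x := t₀)).image_mem_toOpenPartialHomeomorph_target (he t₀) hn, Φ.symm,
    fun ξ hξ => ?_, fun ξ hξ => Φ.right_inv hξ⟩
  exact (Φ.contDiffAt_symm hξ (he _) hΨ.contDiffAt).contDiffWithinAt

theorem Submodule.exists_orthogonal_projection_pi {n : ℕ} (L : Submodule ℝ (Fin n → ℝ)) :
    ∃ π : (Fin n → ℝ) →ₗ[ℝ] (Fin n → ℝ), (∀ v, π v ∈ L) ∧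
      ∀ v, ∀ l ∈ L, ∑ i, l i * (v i - π v i) = 0 := by
  let e := WithLp.linearEquiv 2 ℝ (Fin n → ℝ)
  let L' : Submodule ℝ (EuclideanSpace ℝ (Fin n)) := L.comap e.toLinearMap
  refine ⟨e.toLinearMap ∘ₗ (L'.starProjection : _ →ₗ[ℝ] _) ∘ₗ e.symm.toLinearMap,
    fun v => L'.starProjection_apply_mem (e.symm v), fun v l hl => ?_⟩
  have h := L'.starProjection_inner_eq_zero (e.symm v) (e.symm l) (show e (e.symm l) ∈ L by simpa)
  rw [PiLp.inner_apply] at h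
  exact h

/-- Exponential tilting moves a mean at the rate of the variance; the factor `2` comes from the
squared exponential. -/
theorem hasDerivAt_weighted_mean {ι : Type*} [Fintype ι] (a b : ι → ℝ) (ha : 0 < ∑ i, a i) :
    HasDerivAt (fun s : ℝ => (∑ i, a i) * ((∑ i, a i * Real.exp (s * b i) ^ 2 * b i) /
        ∑ i, a i * Real.exp (s * b i) ^ 2))
      (2 * ∑ i, a i * (b i - (∑ i, a i * b i) / ∑ i, a i) ^ 2) 0 := by
  have he : ∀ i, HasDerivAt (fun s : ℝ => a i * Real.exp (s * b i) ^ 2) (a i * (2 * b i)) 0 := by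
    intro i
    refine HasDerivAt.const_mul _ ?_
    have h := ((((hasDerivAt_id (0 : ℝ)).mul_const (b i)).exp).pow 2)
    exact h.congr_deriv (by simp)
  have hD := HasDerivAt.fun_sum fun i (_ : i ∈ Finset.univ) => he i
  have hN := HasDerivAt.fun_sum fun i (_ : i ∈ Finset.univ) => (he i).mul_const (b i)
  refine ((hN.fun_div hD (by simpa using ha.ne')).const_mul (∑ i, a i)).congr_deriv ?_
  simp only [zero_mul, Real.exp_zero, one_pow, mul_one]
  set C := ∑ i, a i with hC
  set M := ∑ i, a i * b i with hM
  have h1 : ∑ i, a i * (2 * b i) = 2 * M := by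
    rw [hM, Finset.mul_sum]
    exact Finset.sum_congr rfl fun i _ => by ring
  have h2 : ∑ i, a i * (b i - M / C) ^ 2 =
      ∑ i, a i * b i ^ 2 - 2 * (M / C) * M + (M / C) ^ 2 * C := by
    rw [hM, hC, Finset.mul_sum, Finset.mul_sum, ← Finset.sum_sub_distrib,
      ← Finset.sum_add_distrib]
    exact Finset.sum_congr rfl fun i _ => by ring
  have h3 : ∑ i, a i * (2 * b i) * b i = 2 * ∑ i, a i * b i ^ 2 := by
    rw [Finset.mul_sum]
    exact Finset.sum_congr rfl fun i _ => by ring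
  rw [h1, h2, h3]
  field_simp
  ring

section LocalSection

variable {n : ℕ} {lam : Fin n → ℝ} {Q₀ : Matrix (Fin n) (Fin n) ℝ}
  {N : (Fin n → ℝ) → Matrix (Fin n) (Fin n) ℝ}

theorem contDiff_moment_comp (hN : ∀ i j, ContDiff ℝ ∞ fun t => N t i j) :
    ContDiff ℝ ∞ fun t => moment lam (N t) :=
  contDiff_pi.2 fun i => ContDiff.sum fun j _ => contDiff_const.mul ((hN i j).pow 2)

/-- Moving along `v` tilts the squared minors by `exp (s * ∑ j, v (f j)) ^ 2`, renormalized to keep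
their total. The derivative is therefore a positive combination of variances. If it is zero, the
weights are constant on the supported rows. -/
theorem exists_hasDerivAt_sum_mul_moment (hlam : StrictAnti lam)
    (hNO : ∀ t, N t ∈ Matrix.specialOrthogonalGroup (Fin n) ℝ ∧
      ∃ R ∈ UpPos n, N t * R = Matrix.diagonal (fun i => Real.exp (t i)) * Q₀)
    (t v : Fin n → ℝ) :
    ∃ d : ℝ, HasDerivAt (fun s : ℝ => ∑ i, v i * moment lam (N (t + s • v)) i) d 0 ∧ 0 ≤ d ∧
      (d = 0 → v ∈ stabilizerDirections Q₀) := by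
  obtain ⟨c, W, hW, hp⟩ := exists_moment_pairing hlam
  have hO : ∀ t, (N t)ᵀ * N t = 1 := fun t => transpose_mul_self_of_mem (hNO t).1
  have hform : ∀ k : Fin n, ∀ s : ℝ, ∑ f, minor (N (t + s • v)) k f ^ 2 * ∑ j, v (f j) =
      (∑ f, minor (N t) k f ^ 2) *
        ((∑ f, minor (N t) k f ^ 2 * Real.exp (s * ∑ j, v (f j)) ^ 2 * ∑ j, v (f j)) /
          ∑ f, minor (N t) k f ^ 2 * Real.exp (s * ∑ j, v (f j)) ^ 2) := by
    intro k s
    obtain ⟨-, R, hR, hNR⟩ := hNO t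
    obtain ⟨r, hr⟩ := exists_minor_eq_of_mul_eq hR hNR
    obtain ⟨-, R', hR', hNR'⟩ := hNO (t + s • v)
    obtain ⟨r', hr'⟩ := exists_minor_eq_of_mul_eq hR' hNR'
    have hrk := (hr k).1
    have hrk' := (hr' k).1
    set κ := r' k / r k with hκ
    have hκpos : 0 < κ := div_pos hrk' hrk
    have h1 : ∀ f, minor (N (t + s • v)) k f ^ 2 =
        κ ^ 2 * (minor (N t) k f ^ 2 * Real.exp (s * ∑ j, v (f j)) ^ 2) := by
      intro f
      rw [(hr k).2 f, (hr' k).2 f, hκ]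
      simp only [Pi.add_apply, Pi.smul_apply, smul_eq_mul, Finset.sum_add_distrib,
        ← Finset.mul_sum, Real.exp_add]
      field_simp
    have h2 : ∑ f, minor (N t) k f ^ 2 =
        κ ^ 2 * ∑ f, minor (N t) k f ^ 2 * Real.exp (s * ∑ j, v (f j)) ^ 2 := by
      rw [sum_minor_sq (hO t), ← sum_minor_sq (hO (t + s • v)), Finset.mul_sum]
      exact Finset.sum_congr rfl fun f _ => h1 f
    have h3 := sum_minor_sq_pos (hO t) k
    have h4 : ∑ f, minor (N t) k f ^ 2 * Real.exp (s * ∑ j, v (f j)) ^ 2 ≠ 0 := by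
      intro h
      rw [h2, h, mul_zero] at h3
      exact lt_irrefl _ h3
    rw [h2, mul_assoc, mul_div_cancel₀ _ h4, Finset.mul_sum]
    exact Finset.sum_congr rfl fun f _ => by rw [h1]; ring
  have hpos := fun k => sum_minor_sq_pos (hO t) k
  let h : Fin n → ℝ := fun k =>
    (∑ f, minor (N t) k f ^ 2 * ∑ j, v (f j)) / ∑ f, minor (N t) k f ^ 2
  have hterm : ∀ k f, 0 ≤ minor (N t) k f ^ 2 * (∑ j, v (f j) - h k) ^ 2 := fun k f => by
    positivity
  refine ⟨∑ k, W k * (2 * ∑ f, minor (N t) k f ^ 2 * (∑ j, v (f j) - h k) ^ 2), ?_, ?_, ?_⟩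
  · have h1 : (fun s : ℝ => ∑ i, v i * moment lam (N (t + s • v)) i) = fun s => c * ∑ i, v i +
        ∑ k, W k * ((∑ f, minor (N t) k f ^ 2) *
        ((∑ f, minor (N t) k f ^ 2 * Real.exp (s * ∑ j, v (f j)) ^ 2 * ∑ j, v (f j)) /
          ∑ f, minor (N t) k f ^ 2 * Real.exp (s * ∑ j, v (f j)) ^ 2)) := by
      funext s
      rw [hp _ (hO _)]
      congr 1
      exact Finset.sum_congr rfl fun k _ => by rw [hform]
    rw [h1]
    refine HasDerivAt.const_add _ (HasDerivAt.fun_sum fun k _ => HasDerivAt.const_mul _ ?_)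
    exact hasDerivAt_weighted_mean (fun f => minor (N t) k f ^ 2) (fun f => ∑ j, v (f j)) (hpos k)
  · exact Finset.sum_nonneg fun k _ => mul_nonneg (hW k).le
      (mul_nonneg zero_le_two (Finset.sum_nonneg fun f _ => hterm k f))
  · intro h0 k f g hf hg
    have h1 := (Finset.sum_eq_zero_iff_of_nonneg fun k _ => mul_nonneg (hW k).le
      (mul_nonneg zero_le_two (Finset.sum_nonneg fun f _ => hterm k f))).1 h0 k
      (Finset.mem_univ k)
    have h2 := (mul_eq_zero.1 ((mul_eq_zero.1 h1).resolve_left (hW k).ne')).resolve_left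
      two_ne_zero
    have h3 : ∀ f, minor Q₀ k f ≠ 0 → ∑ j, v (f j) = h k := by
      intro f hf
      have h4 := (Finset.sum_eq_zero_iff_of_nonneg fun f _ => hterm k f).1 h2 f
        (Finset.mem_univ f)
      have h5 : minor (N t) k f ≠ 0 := minor_ne_zero_of_mem ⟨(hNO t).1, t, (hNO t).2⟩ hf
      exact sub_eq_zero.1 (pow_eq_zero_iff two_ne_zero |>.1
        ((mul_eq_zero.1 h4).resolve_left (pow_ne_zero 2 h5)))
    rw [h3 f hf, h3 g hg]

/-- Near each of its values on the orbit, the moment map has a smooth section on the affine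
subspace orthogonal to the stabilizer directions. -/
theorem exists_local_section (hlam : StrictAnti lam)
    (h₀ : Q₀ ∈ Matrix.specialOrthogonalGroup (Fin n) ℝ)
    (hN : ∀ i j, ContDiff ℝ ∞ fun t => N t i j)
    (hNO : ∀ t, N t ∈ Matrix.specialOrthogonalGroup (Fin n) ℝ ∧
      ∃ R ∈ UpPos n, N t * R = Matrix.diagonal (fun i => Real.exp (t i)) * Q₀)
    (t₀ : Fin n → ℝ) :
    ∃ U : Set (Fin n → ℝ), IsOpen U ∧ moment lam (N t₀) ∈ U ∧
      ∃ g : (Fin n → ℝ) → (Fin n → ℝ), ContDiffOn ℝ ∞ g U ∧ ∀ ξ ∈ U,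
        (∀ v ∈ stabilizerDirections Q₀, ∑ i, v i * ξ i = ∑ i, v i * moment lam Q₀ i) →
          moment lam (N (g ξ)) = ξ := by
  obtain ⟨π, hπ, hπo⟩ := (stabilizerDirections Q₀).exists_orthogonal_projection_pi
  let π' : (Fin n → ℝ) →L[ℝ] (Fin n → ℝ) := π.toContinuousLinearMap
  have hG := contDiff_moment_comp (lam := lam) hN
  -- The orthogonal projection onto the stabilizer directions compensates for the kernel of the
  -- derivative of the moment: pairing the derivative of `Ψ` along `v` with `v` gives `d + |π v|²`,
  -- a sum of two nonnegative terms.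
  let Ψ : (Fin n → ℝ) → (Fin n → ℝ) := fun t => moment lam (N t) + π' (t - t₀)
  have hΨ : ContDiff ℝ ∞ Ψ := hG.add (π'.contDiff.comp (contDiff_id.sub contDiff_const))
  have hΨ₀ : Ψ t₀ = moment lam (N t₀) := by
    simp only [Ψ, sub_self, map_zero, add_zero]
  have hinj : ∀ t v, fderiv ℝ Ψ t v = 0 → v = 0 := by
    intro t v hv
    have hGd := (hG.differentiable (by simp) t).hasFDerivAt
    set G' := fderiv ℝ (fun t => moment lam (N t)) t with hG'
    have hΨd : HasFDerivAt Ψ (G' + π') t :=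
      hGd.add (π'.hasFDerivAt.comp t ((hasFDerivAt_id t).sub_const t₀))
    rw [hΨd.fderiv] at hv
    obtain ⟨d, hd, hd0, hdL⟩ := exists_hasDerivAt_sum_mul_moment hlam hNO t v
    have hline : HasDerivAt (fun s : ℝ => t + s • v) v 0 := by
      simpa using ((hasDerivAt_id (0 : ℝ)).smul_const v).const_add t
    have hcomp : HasDerivAt (fun s : ℝ => moment lam (N (t + s • v))) (G' v) 0 := by
      have h0 : HasFDerivAt (fun t => moment lam (N t)) G' (t + (0 : ℝ) • v) := by
        simpa using hGd
      exact h0.comp_hasDerivAt (0 : ℝ) hline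
    have hd' : HasDerivAt (fun s : ℝ => ∑ i, v i * moment lam (N (t + s • v)) i)
        (∑ i, v i * G' v i) 0 :=
      HasDerivAt.fun_sum fun i _ => (hasDerivAt_pi.1 hcomp i).const_mul (v i)
    have hdeq := hd.unique hd'
    have h1 : ∑ i, v i * G' v i + ∑ i, v i * π v i = 0 := by
      rw [← Finset.sum_add_distrib]
      refine Finset.sum_eq_zero fun i _ => ?_
      rw [← mul_add]
      exact mul_eq_zero_of_right _ (congrFun hv i)
    have h2 : ∑ i, v i * π v i = ∑ i, π v i ^ 2 := by
      have := hπo v (π v) (hπ v)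
      rw [← sub_eq_zero, ← Finset.sum_sub_distrib, ← this]
      exact Finset.sum_congr rfl fun i _ => by ring
    have h3 : 0 ≤ ∑ i, π v i ^ 2 := Finset.sum_nonneg fun i _ => sq_nonneg _
    have hdz : d = 0 := by
      rw [h2, ← hdeq] at h1
      linarith
    have h4 : ∑ i, π v i ^ 2 = 0 := by
      rw [h2, ← hdeq] at h1
      linarith
    have h5 : ∀ i, π v i = 0 := fun i => pow_eq_zero_iff two_ne_zero |>.1
      ((Finset.sum_eq_zero_iff_of_nonneg fun i _ => sq_nonneg (π v i)).1 h4 i (Finset.mem_univ i))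
    have h6 := hπo v v (hdL hdz)
    simp only [h5, sub_zero] at h6
    funext i
    exact mul_self_eq_zero.1
      ((Finset.sum_eq_zero_iff_of_nonneg fun i _ => mul_self_nonneg (v i)).1 h6 i
        (Finset.mem_univ i))
  obtain ⟨U, hU, hmem, g, hg, hgU⟩ := hΨ.exists_local_right_inverse hinj t₀
  refine ⟨U, hU, hΨ₀ ▸ hmem, g, hg, fun ξ hξ hξL => ?_⟩
  have h1 : ∀ i, ξ i - moment lam (N (g ξ)) i = π (g ξ - t₀) i := fun i => by
    have := congrFun (hgU ξ hξ) i
    rw [← this]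
    simp [Ψ, π']
  have hp := hπ (g ξ - t₀)
  -- On the affine subspace, `ξ - moment lam (N (g ξ))` is orthogonal to the stabilizer directions,
  -- but it also equals `π (g ξ - t₀)`, which is one of them.
  have h2 : ∑ i, π (g ξ - t₀) i * π (g ξ - t₀) i = 0 := by
    simp only [← h1]
    have h3 := hξL _ hp
    have h4 := sum_mul_moment_eq_of_mem (Q := N (g ξ)) (Q' := Q₀) hlam hp
      (subset_closure ⟨(hNO _).1, _, (hNO _).2⟩) (subset_closure (mem_qrOrbit_self h₀))
    have h5 : ∑ i, π (g ξ - t₀) i * (ξ i - moment lam (N (g ξ)) i) = 0 := by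
      simp only [mul_sub, Finset.sum_sub_distrib]
      rw [h3, h4, sub_self]
    simpa only [← h1] using h5
  funext i
  have h3 := mul_self_eq_zero.1
    ((Finset.sum_eq_zero_iff_of_nonneg fun i _ => mul_self_nonneg (π (g ξ - t₀) i)).1 h2 i
      (Finset.mem_univ i))
  have h4 := h1 i
  rw [h3] at h4
  linarith

end LocalSection

/-! ### The image of the orbit and the polytope -/

/-- The affine subspace of the points whose pairings with the stabilizer directions of `Q₀` are
those of the moment of `Q₀`. -/
def momentSubspace {n : ℕ} (lam : Fin n → ℝ) (Q₀ : Matrix (Fin n) (Fin n) ℝ) :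
    AffineSubspace ℝ (Fin n → ℝ) where
  carrier := {x | ∀ v ∈ stabilizerDirections Q₀,
    ∑ i, v i * x i = ∑ i, v i * moment lam Q₀ i}
  smul_vsub_vadd_mem' := fun c x y z hx hy hz v hv => by
    have h1 := hx v hv
    have h2 := hy v hv
    have h3 := hz v hv
    simp only [vsub_eq_sub, vadd_eq_add, Pi.add_apply, Pi.smul_apply, Pi.sub_apply, smul_eq_mul,
      mul_add, Finset.sum_add_distrib, h3]
    have h4 : ∑ i, v i * (c * (x i - y i)) = c * (∑ i, v i * x i - ∑ i, v i * y i) := by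
      rw [← Finset.sum_sub_distrib, Finset.mul_sum]
      exact Finset.sum_congr rfl fun i _ => by ring
    rw [h4, h1, h2, sub_self, mul_zero, zero_add]

theorem convex_halfspace_sum {n : ℕ} (u : Fin n → ℝ) (r : ℝ) :
    Convex ℝ {x : Fin n → ℝ | ∑ i, u i * x i ≤ r} := by
  refine convex_halfSpace_le ⟨fun x y => ?_, fun c x => ?_⟩ r
  · simp only [Pi.add_apply, mul_add, Finset.sum_add_distrib]
  · simp only [Pi.smul_apply, smul_eq_mul, Finset.mul_sum]
    exact Finset.sum_congr rfl fun i _ => by ring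

theorem sum_mul_lineMap {n : ℕ} (u x y : Fin n → ℝ) (s : ℝ) :
    ∑ i, u i * AffineMap.lineMap x y s i =
      (1 - s) * ∑ i, u i * x i + s * ∑ i, u i * y i := by
  rw [Finset.mul_sum, Finset.mul_sum, ← Finset.sum_add_distrib]
  refine Finset.sum_congr rfl fun i _ => ?_
  rw [AffineMap.lineMap_apply_module]
  simp only [Pi.add_apply, Pi.smul_apply, smul_eq_mul]
  ring

theorem exists_gt_lineMap_mem_of_mem_intrinsicInterior {E : Type*} [NormedAddCommGroup E]
    [NormedSpace ℝ E] {P : Set E} {x y : E} (hx : x ∈ intrinsicInterior ℝ P) (hy : y ∈ P) :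
    ∃ s : ℝ, 1 < s ∧ AffineMap.lineMap y x s ∈ P := by
  obtain ⟨z, hz, rfl⟩ := mem_intrinsicInterior.1 hx
  let c : ℝ → affineSpan ℝ P := fun s =>
    ⟨AffineMap.lineMap y (z : E) s, AffineMap.lineMap_mem s (subset_affineSpan ℝ P hy) z.2⟩
  have hc : Continuous c := AffineMap.lineMap_continuous.subtype_mk _
  have hc1 : c 1 = z := Subtype.ext (AffineMap.lineMap_apply_one y (z : E))
  have h1 : ∀ᶠ s in 𝓝 (1 : ℝ), c s ∈ interior ((↑) ⁻¹' P : Set (affineSpan ℝ P)) :=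
    hc.continuousAt.eventually_mem (by rw [hc1]; exact isOpen_interior.mem_nhds hz)
  obtain ⟨s, hs, hs1⟩ := ((h1.filter_mono nhdsWithin_le_nhds).and
    (self_mem_nhdsWithin (a := (1 : ℝ)) (s := Set.Ioi 1))).exists
  have hs2 : c s ∈ ((↑) ⁻¹' P : Set (affineSpan ℝ P)) := interior_subset hs
  exact ⟨s, hs1, hs2⟩

section Polytope

variable {n : ℕ} {lam : Fin n → ℝ} {Q₀ : Matrix (Fin n) (Fin n) ℝ}
  {V : Set (Matrix (Fin n) (Fin n) ℝ)}

theorem eq_param_of_mem_qrOrbit {N : (Fin n → ℝ) → Matrix (Fin n) (Fin n) ℝ}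
    (hNO : ∀ t, N t ∈ Matrix.specialOrthogonalGroup (Fin n) ℝ ∧
      ∃ R ∈ UpPos n, N t * R = Matrix.diagonal (fun i => Real.exp (t i)) * Q₀)
    {Q : Matrix (Fin n) (Fin n) ℝ} (hQ : Q ∈ qrOrbit Q₀) : ∃ t, Q = N t := by
  obtain ⟨hQO, t, R, hR, hQR⟩ := hQ
  obtain ⟨hNt, R', hR', hNR⟩ := hNO t
  obtain ⟨r, hr⟩ := exists_minor_eq_of_mul_eq hR hQR
  obtain ⟨r', hr'⟩ := exists_minor_eq_of_mul_eq hR' hNR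
  refine ⟨t, eq_of_minor_eq (transpose_mul_self_of_mem hQO) (transpose_mul_self_of_mem hNt)
    fun k => ⟨r k / r' k, div_pos (hr k).1 (hr' k).1, fun f => ?_⟩⟩
  rw [(hr k).2, (hr' k).2]
  have := (hr' k).1.ne'
  field_simp

theorem exists_isOpen_inter_subset (hlam : StrictAnti lam)
    (h₀ : Q₀ ∈ Matrix.specialOrthogonalGroup (Fin n) ℝ) {x : Fin n → ℝ}
    (hx : x ∈ moment lam '' qrOrbit Q₀) :
    ∃ U : Set (Fin n → ℝ), IsOpen U ∧ x ∈ U ∧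
      U ∩ momentSubspace lam Q₀ ⊆ moment lam '' qrOrbit Q₀ := by
  obtain ⟨N, hN, hNO⟩ := exists_qrOrbit_param h₀
  obtain ⟨Q, hQ, rfl⟩ := hx
  obtain ⟨t, rfl⟩ := eq_param_of_mem_qrOrbit hNO hQ
  obtain ⟨U, hU, hmem, g, -, hg⟩ := exists_local_section hlam h₀ hN hNO t
  exact ⟨U, hU, hmem, fun ξ hξ => ⟨N (g ξ), ⟨(hNO _).1, _, (hNO _).2⟩, hg ξ hξ.1 hξ.2⟩⟩

theorem isCompact_image_moment : IsCompact (moment lam '' closure (qrOrbit Q₀)) :=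
  isCompact_closure_qrOrbit.image (continuous_moment lam)

theorem affineSpan_convexHull_le (hlam : StrictAnti lam)
    (h₀ : Q₀ ∈ Matrix.specialOrthogonalGroup (Fin n) ℝ) (hV : V ⊆ closure (qrOrbit Q₀)) :
    affineSpan ℝ (convexHull ℝ (moment lam '' V)) ≤ momentSubspace lam Q₀ := by
  rw [affineSpan_convexHull]
  refine affineSpan_le.2 ?_
  rintro _ ⟨Q, hQ, rfl⟩ v hv
  exact sum_mul_moment_eq_of_mem hlam hv (hV hQ) (subset_closure (mem_qrOrbit_self h₀))

theorem image_moment_subset_convexHull (hlam : StrictAnti lam)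
    (h₀ : Q₀ ∈ Matrix.specialOrthogonalGroup (Fin n) ℝ)
    (hV' : ∀ Q ∈ closure (qrOrbit Q₀), IsMonomial Q → Q ∈ V) :
    moment lam '' closure (qrOrbit Q₀) ⊆ convexHull ℝ (moment lam '' V) := by
  rintro _ ⟨Q, hQ, rfl⟩
  exact convexHull_mono (Set.image_mono fun Q hQ => hV' Q hQ.1 hQ.2)
    (moment_mem_convexHull hlam h₀ hQ)

/-- The parameters in `[0, 1)` that land in the image of the orbit form an open set, by the local
sections. They form a closed one too, since no boundary point is met: a functional exposing such a
point is bounded by its value there at `x` and is strictly smaller at the moment of `Q₀`, hence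
strictly smaller on the segment before `x`. -/
theorem lineMap_mem_image_moment (hlam : StrictAnti lam)
    (h₀ : Q₀ ∈ Matrix.specialOrthogonalGroup (Fin n) ℝ) (hV : V ⊆ closure (qrOrbit Q₀))
    {x : Fin n → ℝ} (hx : x ∈ convexHull ℝ (moment lam '' V)) {s : ℝ} (hs : s ∈ Set.Ico 0 1) :
    AffineMap.lineMap (moment lam Q₀) x s ∈ moment lam '' qrOrbit Q₀ := by
  let γ : Set.Ico (0 : ℝ) 1 → (Fin n → ℝ) := fun s => AffineMap.lineMap (moment lam Q₀) x (s : ℝ)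
  have hγ : Continuous γ := AffineMap.lineMap_continuous.comp continuous_subtype_val
  have hself : moment lam Q₀ ∈ moment lam '' qrOrbit Q₀ := ⟨Q₀, mem_qrOrbit_self h₀, rfl⟩
  have hH : ∀ s, γ s ∈ momentSubspace lam Q₀ := fun s =>
    AffineMap.lineMap_mem _ (fun v _ => rfl)
      (affineSpan_convexHull_le hlam h₀ hV (subset_affineSpan ℝ _ hx))
  have hpre : γ ⁻¹' (moment lam '' qrOrbit Q₀) =
      γ ⁻¹' (moment lam '' closure (qrOrbit Q₀)) := by
    refine Set.Subset.antisymm (Set.preimage_mono (Set.image_mono subset_closure)) ?_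
    rintro s ⟨Q, hQ, hQs⟩
    by_cases hQn : Q ∈ qrOrbit Q₀
    · exact ⟨Q, hQn, hQs⟩
    exfalso
    obtain ⟨u, hu, hlt⟩ := exists_supporting_functional hlam h₀ hQ hQn
    have h1 : ∑ i, u i * x i ≤ ∑ i, u i * moment lam Q i := by
      refine convexHull_min (s := moment lam '' V) ?_ (convex_halfspace_sum u _) hx
      rintro _ ⟨Q', hQ', rfl⟩
      exact hu Q' (hV hQ')
    have h2 := hlt Q₀ (mem_qrOrbit_self h₀)
    have h3 := sum_mul_lineMap u (moment lam Q₀) x s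
    have h4 : ∑ i, u i * γ s i = ∑ i, u i * moment lam Q i := by rw [hQs]
    rw [show AffineMap.lineMap (moment lam Q₀) x (s : ℝ) = γ s from rfl, h4] at h3
    have hs0 := s.2.1
    have hs1 := s.2.2
    nlinarith
  have hclopen : IsClopen (γ ⁻¹' (moment lam '' qrOrbit Q₀)) := by
    refine ⟨?_, isOpen_iff_mem_nhds.2 fun s hs => ?_⟩
    · rw [hpre]
      exact isCompact_image_moment.isClosed.preimage hγ
    · obtain ⟨U, hU, hmem, hsub⟩ := exists_isOpen_inter_subset hlam h₀ hs
      exact mem_of_superset ((hU.preimage hγ).mem_nhds hmem) fun s' hs' => hsub ⟨hs', hH s'⟩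
  have : PreconnectedSpace (Set.Ico (0 : ℝ) 1) :=
    Subtype.preconnectedSpace isPreconnected_Ico
  have huniv := hclopen.eq_univ ⟨⟨0, by simp⟩, by
    simpa only [Set.mem_preimage, γ, AffineMap.lineMap_apply_zero] using hself⟩
  have hmem : (⟨s, hs⟩ : Set.Ico (0 : ℝ) 1) ∈ γ ⁻¹' (moment lam '' qrOrbit Q₀) := by
    rw [huniv]
    trivial
  exact hmem

theorem image_moment_closure_eq (hlam : StrictAnti lam)
    (h₀ : Q₀ ∈ Matrix.specialOrthogonalGroup (Fin n) ℝ) (hV : V ⊆ closure (qrOrbit Q₀))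
    (hV' : ∀ Q ∈ closure (qrOrbit Q₀), IsMonomial Q → Q ∈ V) :
    moment lam '' closure (qrOrbit Q₀) = convexHull ℝ (moment lam '' V) := by
  refine Set.Subset.antisymm (image_moment_subset_convexHull hlam h₀ hV') fun x hx => ?_
  have hlim : Tendsto (fun s : ℝ => AffineMap.lineMap (moment lam Q₀) x s) (𝓝[<] 1) (𝓝 x) := by
    have h := (AffineMap.lineMap_continuous (R := ℝ) (p := moment lam Q₀) (q := x)).tendsto 1
    rw [AffineMap.lineMap_apply_one] at h
    exact h.mono_left nhdsWithin_le_nhds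
  refine isCompact_image_moment.isClosed.mem_of_tendsto hlim ?_
  filter_upwards [Ico_mem_nhdsLT (show (0 : ℝ) < 1 by norm_num)] with s hs
  exact Set.image_mono subset_closure (lineMap_mem_image_moment hlam h₀ hV hx hs)

theorem image_moment_eq_intrinsicInterior (hlam : StrictAnti lam)
    (h₀ : Q₀ ∈ Matrix.specialOrthogonalGroup (Fin n) ℝ) (hV : V ⊆ closure (qrOrbit Q₀))
    (hV' : ∀ Q ∈ closure (qrOrbit Q₀), IsMonomial Q → Q ∈ V) :
    moment lam '' qrOrbit Q₀ = intrinsicInterior ℝ (convexHull ℝ (moment lam '' V)) := by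
  have hsub : moment lam '' qrOrbit Q₀ ⊆ convexHull ℝ (moment lam '' V) :=
    (Set.image_mono subset_closure).trans (image_moment_subset_convexHull hlam h₀ hV')
  refine Set.Subset.antisymm (fun x hx => ?_) fun x hx => ?_
  · obtain ⟨U, hU, hmem, hUH⟩ := exists_isOpen_inter_subset hlam h₀ hx
    refine mem_intrinsicInterior.2 ⟨⟨x, subset_affineSpan ℝ _ (hsub hx)⟩, ?_, rfl⟩
    refine mem_interior.2 ⟨Subtype.val ⁻¹' U, fun z hz => hsub (hUH ⟨hz, ?_⟩),
      hU.preimage continuous_subtype_val, hmem⟩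
    exact affineSpan_convexHull_le hlam h₀ hV z.2
  -- The segment from the moment of `Q₀` to `x` can be prolonged inside the polytope, which puts `x`
  -- at parameter `s⁻¹ < 1` of a longer segment.
  · obtain ⟨s, hs, hmem⟩ := exists_gt_lineMap_mem_of_mem_intrinsicInterior hx
      (hsub ⟨Q₀, mem_qrOrbit_self h₀, rfl⟩)
    have h1 := lineMap_mem_image_moment hlam h₀ hV hmem (s := s⁻¹)
      ⟨by positivity, inv_lt_one_of_one_lt₀ hs⟩
    have h2 : AffineMap.lineMap (moment lam Q₀) (AffineMap.lineMap (moment lam Q₀) x s) s⁻¹ = x := by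
      have : s ≠ 0 := by positivity
      ext i
      simp only [AffineMap.lineMap_apply_module', Pi.add_apply, Pi.smul_apply, Pi.sub_apply,
        smul_eq_mul]
      field_simp
      ring
    rwa [h2] at h1

/-- The image of the orbit is open in `momentSubspace`, so it contains a small contraction of any
point towards the moment of `Q₀`. -/
theorem affineSpan_convexHull_eq (hlam : StrictAnti lam)
    (h₀ : Q₀ ∈ Matrix.specialOrthogonalGroup (Fin n) ℝ) (hV : V ⊆ closure (qrOrbit Q₀))
    (hV' : ∀ Q ∈ closure (qrOrbit Q₀), IsMonomial Q → Q ∈ V) :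
    affineSpan ℝ (convexHull ℝ (moment lam '' V)) = momentSubspace lam Q₀ := by
  refine le_antisymm (affineSpan_convexHull_le hlam h₀ hV) fun y hy => ?_
  have hsub : moment lam '' qrOrbit Q₀ ⊆ convexHull ℝ (moment lam '' V) :=
    (Set.image_mono subset_closure).trans (image_moment_subset_convexHull hlam h₀ hV')
  have hself : moment lam Q₀ ∈ moment lam '' qrOrbit Q₀ := ⟨Q₀, mem_qrOrbit_self h₀, rfl⟩
  obtain ⟨U, hU, hmem, hUH⟩ := exists_isOpen_inter_subset hlam h₀ hself
  have hev : ∀ᶠ s in 𝓝 (0 : ℝ), AffineMap.lineMap (moment lam Q₀) y s ∈ U := by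
    refine (AffineMap.lineMap_continuous (R := ℝ)).continuousAt.eventually_mem ?_
    rw [AffineMap.lineMap_apply_zero]
    exact hU.mem_nhds hmem
  obtain ⟨s, hs, hs0⟩ := ((hev.filter_mono nhdsWithin_le_nhds).and
    (self_mem_nhdsWithin (a := (0 : ℝ)) (s := Set.Ioi 0))).exists
  have hs0' : (0 : ℝ) < s := hs0
  have h1 : AffineMap.lineMap (moment lam Q₀) y s ∈
      affineSpan ℝ (convexHull ℝ (moment lam '' V)) :=
    subset_affineSpan ℝ _ (hsub (hUH ⟨hs, AffineMap.lineMap_mem _ (fun v _ => rfl) hy⟩))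
  have h2 := AffineMap.lineMap_mem s⁻¹ (subset_affineSpan ℝ _ (hsub hself)) h1
  have h3 : AffineMap.lineMap (moment lam Q₀) (AffineMap.lineMap (moment lam Q₀) y s) s⁻¹ = y := by
    ext i
    simp only [AffineMap.lineMap_apply_module', Pi.add_apply, Pi.smul_apply, Pi.sub_apply,
      smul_eq_mul]
    field_simp
    ring
  rwa [h3] at h2

end Polytope

/-! ### The BFR map as a polynomial -/

section Bfr

variable {n : ℕ}

theorem aeval_conj_diagonal {lam : Fin n → ℝ} {Q : Matrix (Fin n) (Fin n) ℝ} (hQ : Qᵀ * Q = 1)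
    (p : Polynomial ℝ) :
    Polynomial.aeval (Qᵀ * Matrix.diagonal lam * Q) p =
      Qᵀ * Matrix.diagonal (fun i => p.eval (lam i)) * Q := by
  have hQ1 : Q * Qᵀ = 1 := mul_eq_one_comm.1 hQ
  have hpow : ∀ m : ℕ, (Qᵀ * Matrix.diagonal lam * Q) ^ m =
      Qᵀ * Matrix.diagonal (fun i => lam i ^ m) * Q := by
    intro m
    induction m with
    | zero => simp [hQ]
    | succ m ih =>
      rw [pow_succ, ih]
      calc Qᵀ * Matrix.diagonal (fun i => lam i ^ m) * Q * (Qᵀ * Matrix.diagonal lam * Q)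
          = Qᵀ * Matrix.diagonal (fun i => lam i ^ m) * (Q * Qᵀ) * Matrix.diagonal lam * Q := by
            simp only [Matrix.mul_assoc]
        _ = _ := by
            rw [hQ1, Matrix.mul_one, Matrix.mul_assoc Qᵀ, Matrix.diagonal_mul_diagonal]
            rfl
  induction p using Polynomial.induction_on' with
  | add p q hp hq =>
    rw [map_add, hp, hq, ← Matrix.add_mul, ← Matrix.mul_add, Matrix.diagonal_add]
    simp only [Polynomial.eval_add]
  | monomial m a =>
    rw [Polynomial.aeval_monomial, hpow, ← Algebra.smul_def, ← Matrix.smul_mul, ← Matrix.mul_smul,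
      ← Matrix.diagonal_smul]
    simp only [Polynomial.eval_monomial]
    rfl

/-- A polynomial map extending the BFR map. -/
def bfrPolynomial (lam : Fin n → ℝ) (T : Matrix (Fin n) (Fin n) ℝ) (i : Fin n) : ℝ :=
  ∑ j, lam j * Polynomial.aeval T (Lagrange.basis Finset.univ lam i) j j

theorem contDiff_bfrPolynomial (lam : Fin n → ℝ) : ContDiff ℝ ∞ (bfrPolynomial lam) := by
  have hpow : ∀ (m : ℕ) (a b : Fin n),
      ContDiff ℝ ∞ fun T : Matrix (Fin n) (Fin n) ℝ => (T ^ m) a b := by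
    intro m
    induction m with
    | zero =>
      intro a b
      simp only [pow_zero]
      exact contDiff_const
    | succ m ih =>
      intro a b
      simp only [pow_succ, Matrix.mul_apply]
      exact ContDiff.sum fun l _ => (ih a l).mul (contDiff_apply_apply ℝ ℝ l b)
  have haeval : ∀ (p : Polynomial ℝ) (a b : Fin n),
      ContDiff ℝ ∞ fun T : Matrix (Fin n) (Fin n) ℝ => Polynomial.aeval T p a b := by
    intro p a b
    simp only [Polynomial.aeval_eq_sum_range, Matrix.sum_apply, Matrix.smul_apply, smul_eq_mul]
    exact ContDiff.sum fun m _ => contDiff_const.mul (hpow m a b)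
  exact contDiff_pi.2 fun i => ContDiff.sum fun j _ => contDiff_const.mul (haeval _ j j)

theorem bfr_conj {lam : Fin n → ℝ} (hlam : StrictAnti lam) {Q : Matrix (Fin n) (Fin n) ℝ}
    (hQ : Q ∈ Matrix.specialOrthogonalGroup (Fin n) ℝ) :
    bfr lam (Qᵀ * Matrix.diagonal lam * Q) = moment lam Q := by
  rw [bfr_eq hlam.injective hQ]
  funext i
  exact diag_conj_apply lam Q i

/-- The Lagrange basis polynomial at `lam i`, evaluated at `Qᵀ Λ Q`, is the projection onto the
`i`-th eigenline, whose diagonal entries are `Q i j ^ 2`. -/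
theorem bfrPolynomial_conj {lam : Fin n → ℝ} (hlam : StrictAnti lam)
    {Q : Matrix (Fin n) (Fin n) ℝ} (hQ : Q ∈ Matrix.specialOrthogonalGroup (Fin n) ℝ) :
    bfrPolynomial lam (Qᵀ * Matrix.diagonal lam * Q) = moment lam Q := by
  funext i
  refine Finset.sum_congr rfl fun j _ => ?_
  rw [aeval_conj_diagonal (transpose_mul_self_of_mem hQ), Matrix.mul_apply,
    Finset.sum_eq_single i]
  · rw [Matrix.mul_diagonal, Matrix.transpose_apply,
      Lagrange.eval_basis_self (hlam.injective.injOn) (Finset.mem_univ i)]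
    ring
  · intro l _ hl
    rw [Matrix.mul_diagonal, Lagrange.eval_basis_of_ne hl.symm (Finset.mem_univ l)]
    ring
  · simp

end Bfr

/-! ### The slice as the image of a torus orbit -/

section Slice

variable {n : ℕ} {lam : Fin n → ℝ} {Q₀ S : Matrix (Fin n) (Fin n) ℝ}

theorem exists_orthogonal_diagonalization (hS : S.IsSymm) (hlam : StrictAnti lam)
    (hspec : spectrum ℝ S = Set.range lam) :
    ∃ V : Matrix (Fin n) (Fin n) ℝ, Vᵀ * V = 1 ∧ S = Vᵀ * Matrix.diagonal lam * V := by
  have hex : ∀ i, ∃ v : Fin n → ℝ, v ≠ 0 ∧ S *ᵥ v = lam i • v := by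
    intro i
    have h1 : lam i ∈ spectrum ℝ S := hspec ▸ ⟨i, rfl⟩
    rw [spectrum.mem_iff, Matrix.isUnit_iff_isUnit_det, isUnit_iff_ne_zero, not_not] at h1
    obtain ⟨v, hv, h2⟩ := Matrix.exists_mulVec_eq_zero_iff.2 h1
    refine ⟨v, hv, ?_⟩
    rw [Matrix.sub_mulVec, Algebra.algebraMap_eq_smul_one, Matrix.smul_mulVec, Matrix.one_mulVec,
      sub_eq_zero] at h2
    exact h2.symm
  choose v hv0 hv using hex
  have hpos : ∀ i, 0 < v i ⬝ᵥ v i := fun i => by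
    refine lt_of_le_of_ne (Finset.sum_nonneg fun j _ => mul_self_nonneg (v i j)) fun h => ?_
    exact hv0 i (dotProduct_self_eq_zero.1 h.symm)
  have hort : ∀ i j, i ≠ j → v i ⬝ᵥ v j = 0 := by
    intro i j hij
    have h1 : (S *ᵥ v i) ⬝ᵥ v j = v i ⬝ᵥ (S *ᵥ v j) := by
      rw [Matrix.dotProduct_mulVec, ← Matrix.mulVec_transpose, hS]
    rw [hv, hv, smul_dotProduct, dotProduct_smul, smul_eq_mul, smul_eq_mul] at h1
    have h2 : (lam i - lam j) * (v i ⬝ᵥ v j) = 0 := by linear_combination h1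
    exact (mul_eq_zero.1 h2).resolve_left (sub_ne_zero.2 (hlam.injective.ne hij))
  set V : Matrix (Fin n) (Fin n) ℝ :=
    Matrix.of fun i => (Real.sqrt (v i ⬝ᵥ v i))⁻¹ • v i with hV
  have hVV : V * Vᵀ = 1 := by
    ext i j
    have h1 : (V * Vᵀ) i j =
        (Real.sqrt (v i ⬝ᵥ v i))⁻¹ * (Real.sqrt (v j ⬝ᵥ v j))⁻¹ * (v i ⬝ᵥ v j) := by
      have h2 : v i ⬝ᵥ v j = ∑ l, v i l * v j l := rfl
      rw [Matrix.mul_apply, h2, Finset.mul_sum]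
      refine Finset.sum_congr rfl fun l _ => ?_
      simp only [hV, Matrix.of_apply, Matrix.transpose_apply, Pi.smul_apply, smul_eq_mul]
      ring
    rw [h1]
    rcases eq_or_ne i j with rfl | hij
    · rw [Matrix.one_apply_eq, ← mul_inv, Real.mul_self_sqrt (hpos i).le,
        inv_mul_cancel₀ (hpos i).ne']
    · rw [hort i j hij, mul_zero, Matrix.one_apply_ne hij]
  have hVS : V * S = Matrix.diagonal lam * V := by
    ext i j
    have h1 := congrFun (hv i) j
    rw [Matrix.diagonal_mul, Matrix.mul_apply]
    simp only [hV, Matrix.of_apply, Pi.smul_apply, smul_eq_mul] at h1 ⊢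
    have h2 : (S *ᵥ v i) j = ∑ l, v i l * S l j := by
      rw [Matrix.mulVec, dotProduct]
      exact Finset.sum_congr rfl fun l _ => by rw [← hS.apply l j, mul_comm]
    calc ∑ l, (Real.sqrt (v i ⬝ᵥ v i))⁻¹ * v i l * S l j
        = (Real.sqrt (v i ⬝ᵥ v i))⁻¹ * ∑ l, v i l * S l j := by
          rw [Finset.mul_sum]
          exact Finset.sum_congr rfl fun l _ => by ring
      _ = _ := by
          rw [← h2, h1]
          ring
  have hVV' : Vᵀ * V = 1 := mul_eq_one_comm.1 hVV
  refine ⟨V, hVV', ?_⟩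
  rw [Matrix.mul_assoc, ← hVS, ← Matrix.mul_assoc, hVV', Matrix.one_mul]

theorem exists_special_orthogonal_diagonalization (hS : S.IsSymm) (hlam : StrictAnti lam)
    (hspec : spectrum ℝ S = Set.range lam) :
    ∃ Q ∈ Matrix.specialOrthogonalGroup (Fin n) ℝ, S = Qᵀ * Matrix.diagonal lam * Q := by
  obtain ⟨V, hV, hSV⟩ := exists_orthogonal_diagonalization hS hlam hspec
  rcases le_or_gt V.det 0 with hdet | hdet
  swap
  · exact ⟨V, mem_specialOrthogonalGroup_of hV hdet, hSV⟩
  have hne : V.det ≠ 0 := by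
    intro h
    have h1 := congrArg Matrix.det hV
    rw [Matrix.det_mul, h, mul_zero, Matrix.det_one] at h1
    exact zero_ne_one h1
  obtain ⟨i₀⟩ : Nonempty (Fin n) := by
    by_contra hempty
    rw [not_nonempty_iff] at hempty
    rw [Matrix.det_isEmpty] at hdet
    linarith
  -- Changing the sign of one row of `V` corrects the determinant and leaves `Vᵀ Λ V` unchanged.
  set ε : Fin n → ℝ := Function.update 1 i₀ (-1) with hε
  have hε2 : ∀ i, ε i * ε i = 1 := by
    intro i
    rcases eq_or_ne i i₀ with rfl | h
    · simp [hε]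
    · simp [hε, h]
  have hDD : Matrix.diagonal ε * Matrix.diagonal ε = 1 := by
    rw [Matrix.diagonal_mul_diagonal]
    simp [hε2]
  have hDLD : Matrix.diagonal ε * Matrix.diagonal lam * Matrix.diagonal ε =
      Matrix.diagonal lam := by
    rw [Matrix.diagonal_mul_diagonal, Matrix.diagonal_mul_diagonal]
    congr 1
    funext i
    rw [mul_right_comm, hε2, one_mul]
  refine ⟨Matrix.diagonal ε * V, mem_specialOrthogonalGroup_of ?_ ?_, ?_⟩
  · rw [Matrix.transpose_mul, Matrix.diagonal_transpose, Matrix.mul_assoc,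
      ← Matrix.mul_assoc (Matrix.diagonal ε), hDD, Matrix.one_mul, hV]
  · have hprod : ∏ i, ε i = -1 := by
      rw [hε, Finset.prod_update_of_mem (Finset.mem_univ i₀)]
      simp
    rw [Matrix.det_mul, Matrix.det_diagonal, hprod]
    have := lt_of_le_of_ne hdet hne
    linarith
  · rw [Matrix.transpose_mul, Matrix.diagonal_transpose]
    calc S = Vᵀ * (Matrix.diagonal ε * Matrix.diagonal lam * Matrix.diagonal ε) * V := by
          rw [hDLD, hSV]
      _ = _ := by simp only [Matrix.mul_assoc]

/-- The two descriptions of `T` show that `P * R` commutes with `S`, so `M = Q₀ P R Q₀ᵀ` commutes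
with `Λ` and is diagonal by simplicity of the spectrum. The signs of `M` are absorbed into the
orthogonal factor, and its absolute values are the `exp (t i)`. -/
theorem slice_subset (hlam : StrictAnti lam) (h₀ : Q₀ ∈ Matrix.specialOrthogonalGroup (Fin n) ℝ)
    (hS : S = Q₀ᵀ * Matrix.diagonal lam * Q₀) :
    slice S ⊆ (fun Q => Qᵀ * Matrix.diagonal lam * Q) '' qrOrbit Q₀ := by
  rintro T ⟨⟨P, hP, hT⟩, R, hR, hTR⟩
  have hQ₀ := transpose_mul_self_of_mem h₀
  have hQ₀' : Q₀ * Q₀ᵀ = 1 := mul_eq_one_comm.1 hQ₀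
  have hPP := transpose_mul_self_of_mem hP
  have hPP' : P * Pᵀ = 1 := mul_eq_one_comm.1 hPP
  have hRdet := det_pos_of_mem_upPos hR
  have hTR' : T * R = R * S := by
    rw [hTR, Matrix.mul_assoc, Matrix.nonsing_inv_mul R (isUnit_iff_ne_zero.2 hRdet.ne'),
      Matrix.mul_one]
  have hcomm : P * R * S = S * (P * R) := by
    calc P * R * S = P * (T * R) := by rw [hTR', Matrix.mul_assoc]
      _ = (P * Pᵀ) * S * (P * R) := by rw [hT]; simp only [Matrix.mul_assoc]
      _ = _ := by rw [hPP', Matrix.one_mul]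
  have hQS : Q₀ * S = Matrix.diagonal lam * Q₀ := by
    rw [hS, ← Matrix.mul_assoc, ← Matrix.mul_assoc, hQ₀', Matrix.one_mul]
  have hSQ : S * Q₀ᵀ = Q₀ᵀ * Matrix.diagonal lam := by
    rw [hS, Matrix.mul_assoc, hQ₀', Matrix.mul_one]
  set M := Q₀ * (P * R) * Q₀ᵀ with hM
  have hMc : M * Matrix.diagonal lam = Matrix.diagonal lam * M := by
    calc M * Matrix.diagonal lam = Q₀ * (P * R) * (S * Q₀ᵀ) := by
          rw [hSQ, hM, Matrix.mul_assoc]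
      _ = Q₀ * (P * R * S) * Q₀ᵀ := by simp only [Matrix.mul_assoc]
      _ = (Q₀ * S) * (P * R) * Q₀ᵀ := by rw [hcomm]; simp only [Matrix.mul_assoc]
      _ = _ := by rw [hQS, hM]; simp only [Matrix.mul_assoc]
  have hMd : M = Matrix.diagonal fun i => M i i := by
    ext i j
    rcases eq_or_ne i j with rfl | hij
    · simp
    · have h1 := congrFun (congrFun hMc i) j
      rw [Matrix.mul_diagonal, Matrix.diagonal_mul] at h1
      have h2 : M i j * (lam j - lam i) = 0 := by linear_combination h1
      rw [Matrix.diagonal_apply_ne _ hij]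
      exact (mul_eq_zero.1 h2).resolve_right (sub_ne_zero.2 (hlam.injective.ne hij.symm))
  have hMdet : M.det = R.det := by
    rw [hM, Matrix.det_mul, Matrix.det_mul, Matrix.det_mul, Matrix.det_transpose,
      (Matrix.mem_specialOrthogonalGroup_iff.1 h₀).2,
      (Matrix.mem_specialOrthogonalGroup_iff.1 hP).2]
    ring
  have hMne : ∀ i, M i i ≠ 0 := by
    have h1 : M.det ≠ 0 := hMdet ▸ hRdet.ne'
    rw [hMd, Matrix.det_diagonal] at h1
    exact fun i => Finset.prod_ne_zero_iff.1 h1 i (Finset.mem_univ i)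
  let ε : Fin n → ℝ := fun i => |M i i| / M i i
  have hε2 : ∀ i, ε i * ε i = 1 := fun i => by
    have := hMne i
    simp only [ε]
    rw [div_mul_div_comm, abs_mul_abs_self, div_self (mul_ne_zero this this)]
  have hDD : Matrix.diagonal ε * Matrix.diagonal ε = 1 := by
    rw [Matrix.diagonal_mul_diagonal]
    simp [hε2]
  have hDLD : Matrix.diagonal ε * Matrix.diagonal lam * Matrix.diagonal ε =
      Matrix.diagonal lam := by
    rw [Matrix.diagonal_mul_diagonal, Matrix.diagonal_mul_diagonal]
    congr 1
    funext i
    rw [mul_right_comm, hε2, one_mul]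
  have hQR : Matrix.diagonal ε * (Q₀ * P) * R = Matrix.diagonal (fun i => |M i i|) * Q₀ := by
    have h1 : Q₀ * P * R = Matrix.diagonal (fun i => M i i) * Q₀ := by
      rw [← hMd, hM, Matrix.mul_assoc _ Q₀ᵀ, hQ₀, Matrix.mul_one, Matrix.mul_assoc]
    rw [Matrix.mul_assoc, h1, ← Matrix.mul_assoc, Matrix.diagonal_mul_diagonal]
    congr 2
    funext i
    simp only [ε]
    rw [div_mul_cancel₀ _ (hMne i)]
  have horth : (Matrix.diagonal ε * (Q₀ * P))ᵀ * (Matrix.diagonal ε * (Q₀ * P)) = 1 := by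
    rw [Matrix.transpose_mul, Matrix.diagonal_transpose, Matrix.mul_assoc,
      ← Matrix.mul_assoc (Matrix.diagonal ε), hDD, Matrix.one_mul, Matrix.transpose_mul,
      Matrix.mul_assoc, ← Matrix.mul_assoc Q₀ᵀ, hQ₀, Matrix.one_mul, hPP]
  refine ⟨Matrix.diagonal ε * (Q₀ * P), ⟨mem_specialOrthogonalGroup_of_mul_eq h₀ horth
    (fun i => abs_pos.2 (hMne i)) hR hQR, fun i => Real.log |M i i|, R, hR, ?_⟩, ?_⟩
  · rw [hQR]
    congr 2
    funext i
    rw [Real.exp_log (abs_pos.2 (hMne i))]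
  · change (Matrix.diagonal ε * (Q₀ * P))ᵀ * Matrix.diagonal lam *
      (Matrix.diagonal ε * (Q₀ * P)) = T
    rw [hT, hS, ← hDLD]
    simp only [Matrix.transpose_mul, Matrix.diagonal_transpose, Matrix.mul_assoc]
    rw [← Matrix.mul_assoc (Matrix.diagonal ε) (Matrix.diagonal ε), hDD, Matrix.one_mul,
      ← Matrix.mul_assoc (Matrix.diagonal ε) (Matrix.diagonal ε), hDD, Matrix.one_mul,
      ← Matrix.mul_assoc (Matrix.diagonal lam) (Matrix.diagonal ε),
      ← Matrix.mul_assoc (Matrix.diagonal ε), ← Matrix.mul_assoc (Matrix.diagonal ε), hDLD]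

theorem subset_slice (h₀ : Q₀ ∈ Matrix.specialOrthogonalGroup (Fin n) ℝ)
    (hS : S = Q₀ᵀ * Matrix.diagonal lam * Q₀) :
    (fun Q => Qᵀ * Matrix.diagonal lam * Q) '' qrOrbit Q₀ ⊆ slice S := by
  rintro _ ⟨Q, ⟨hQ, t, R, hR, hQR⟩, rfl⟩
  have hQ₀ := transpose_mul_self_of_mem h₀
  have hQ₀' : Q₀ * Q₀ᵀ = 1 := mul_eq_one_comm.1 hQ₀
  have hQQ := transpose_mul_self_of_mem hQ
  refine ⟨⟨Q₀ᵀ * Q, mul_mem ?_ hQ, ?_⟩, R, hR, ?_⟩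
  · refine mem_specialOrthogonalGroup_of ?_ ?_
    · rw [Matrix.transpose_transpose, hQ₀']
    · rw [Matrix.det_transpose, (Matrix.mem_specialOrthogonalGroup_iff.1 h₀).2]
      exact one_pos
  · rw [hS, Matrix.transpose_mul, Matrix.transpose_transpose]
    calc Qᵀ * Matrix.diagonal lam * Q
        = Qᵀ * (Q₀ * Q₀ᵀ) * Matrix.diagonal lam * (Q₀ * Q₀ᵀ) * Q := by
          rw [hQ₀', Matrix.mul_one, Matrix.mul_one]
      _ = _ := by simp only [Matrix.mul_assoc]
  · have hQS : Q₀ * S = Matrix.diagonal lam * Q₀ := by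
      rw [hS, ← Matrix.mul_assoc, ← Matrix.mul_assoc, hQ₀', Matrix.one_mul]
    set E : Matrix (Fin n) (Fin n) ℝ := Matrix.diagonal fun i => Real.exp (t i) with hE
    have hEc : Matrix.diagonal lam * E = E * Matrix.diagonal lam := by
      rw [hE, Matrix.diagonal_mul_diagonal, Matrix.diagonal_mul_diagonal]
      simp only [mul_comm]
    have h1 : Qᵀ * Matrix.diagonal lam * Q * R = R * S := by
      calc Qᵀ * Matrix.diagonal lam * Q * R = Qᵀ * (Matrix.diagonal lam * E) * Q₀ := by
            rw [Matrix.mul_assoc, hQR]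
            simp only [Matrix.mul_assoc]
        _ = Qᵀ * (E * Q₀) * S := by
            rw [hEc]
            simp only [Matrix.mul_assoc, hQS]
        _ = R * S := by
            rw [← hQR, ← Matrix.mul_assoc, hQQ, Matrix.one_mul]
    change Qᵀ * Matrix.diagonal lam * Q = R * S * R⁻¹
    rw [← h1, Matrix.mul_assoc _ R,
      Matrix.mul_nonsing_inv R (isUnit_iff_ne_zero.2 (det_pos_of_mem_upPos hR).ne'),
      Matrix.mul_one]

theorem slice_eq_image (hlam : StrictAnti lam)
    (h₀ : Q₀ ∈ Matrix.specialOrthogonalGroup (Fin n) ℝ)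
    (hS : S = Q₀ᵀ * Matrix.diagonal lam * Q₀) :
    slice S = (fun Q => Qᵀ * Matrix.diagonal lam * Q) '' qrOrbit Q₀ :=
  Set.Subset.antisymm (slice_subset hlam h₀ hS) (subset_slice h₀ hS)

theorem closure_slice_eq_image (hlam : StrictAnti lam)
    (h₀ : Q₀ ∈ Matrix.specialOrthogonalGroup (Fin n) ℝ)
    (hS : S = Q₀ᵀ * Matrix.diagonal lam * Q₀) :
    closure (slice S) = (fun Q => Qᵀ * Matrix.diagonal lam * Q) '' closure (qrOrbit Q₀) := by
  rw [slice_eq_image hlam h₀ hS]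
  have hc : Continuous fun Q : Matrix (Fin n) (Fin n) ℝ => Qᵀ * Matrix.diagonal lam * Q :=
    (continuous_id.matrix_transpose.matrix_mul continuous_const).matrix_mul continuous_id
  exact (image_closure_of_isCompact isCompact_closure_qrOrbit hc.continuousOn).symm

end Slice

/-! ### Irreducibility and the affine span -/

section Irreducible

variable {n : ℕ} {lam : Fin n → ℝ} {Q₀ : Matrix (Fin n) (Fin n) ℝ}

theorem mem_canonicalSubspace_iff {I : Set (Fin n)} {w : Fin n → ℝ} :
    w ∈ canonicalSubspace I ↔ ∀ j ∉ I, w j = 0 := by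
  constructor
  · intro hw j hj
    induction hw using Submodule.span_induction with
    | mem x hx =>
      obtain ⟨i, hi, rfl⟩ := hx
      exact Pi.single_eq_of_ne (by rintro rfl; exact hj hi) _
    | zero => rfl
    | add x y _ _ hx hy => rw [Pi.add_apply, hx, hy, add_zero]
    | smul c x _ hx => rw [Pi.smul_apply, hx, smul_zero]
  · intro h
    rw [pi_eq_sum_univ' w]
    refine Submodule.sum_mem _ fun j _ => ?_
    by_cases hj : j ∈ I
    · exact Submodule.smul_mem _ _ (Submodule.subset_span ⟨j, hj, rfl⟩)
    · rw [h j hj, zero_smul]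
      exact Submodule.zero_mem _

/-- The torus along `v` fixes `Q₀`, so `R = Q₀ᵀ exp (diag v) Q₀` is at once symmetric and
triangular, hence diagonal. Then compare the entries of `Q₀ R = exp (diag v) Q₀`. -/
theorem exp_eq_of_mem_stabilizerDirections
    (h₀ : Q₀ ∈ Matrix.specialOrthogonalGroup (Fin n) ℝ) {v : Fin n → ℝ}
    (hv : v ∈ stabilizerDirections Q₀) :
    ∃ d : Fin n → ℝ, ∀ i j, Q₀ i j ≠ 0 → Real.exp (v i) = d j := by
  obtain ⟨N, -, hNO⟩ := exists_qrOrbit_param h₀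
  obtain ⟨hN, R, hR, hNR⟩ := hNO v
  have hQ₀ := transpose_mul_self_of_mem h₀
  obtain ⟨r, hr⟩ := exists_minor_eq_of_mul_eq hR hNR
  choose b hb using exists_minor_ne_zero hQ₀
  have hNQ : N v = Q₀ := by
    refine eq_of_minor_eq (transpose_mul_self_of_mem hN) hQ₀ fun k =>
      ⟨r k * Real.exp (∑ j, v (b k j)), mul_pos (hr k).1 (Real.exp_pos _), fun f => ?_⟩
    by_cases hf : minor Q₀ k f = 0
    · rw [(hr k).2, hf, mul_zero, mul_zero]
    · rw [(hr k).2, hv k f (b k) hf (hb k)]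
  rw [hNQ] at hNR
  have hRE : R = Q₀ᵀ * (Matrix.diagonal (fun i => Real.exp (v i)) * Q₀) := by
    rw [← hNR, ← Matrix.mul_assoc, hQ₀, Matrix.one_mul]
  have hRT : Rᵀ = R := by
    conv_lhs => rw [hRE]
    rw [Matrix.transpose_mul, Matrix.transpose_mul, Matrix.transpose_transpose,
      Matrix.diagonal_transpose, Matrix.mul_assoc, ← hRE]
  have hRd : ∀ i j, i ≠ j → R i j = 0 := by
    intro i j hij
    rcases lt_or_gt_of_ne hij with h | h
    · rw [← hRT, Matrix.transpose_apply]
      exact hR.1 h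
    · exact hR.1 h
  refine ⟨fun j => R j j, fun i j hij => ?_⟩
  have h1 := congrFun (congrFun hNR i) j
  rw [Matrix.diagonal_mul, Matrix.mul_apply,
    Finset.sum_eq_single j (fun l _ hl => by rw [hRd l j hl, mul_zero]) (by simp)] at h1
  exact (mul_left_cancel₀ hij (by rw [h1, mul_comm])).symm

/-- Otherwise the level sets of `d` split the columns of `Q₀` into blocks supported on disjoint sets
of rows. Then `Q₀ᵀ Λ Q₀` has no entries between different blocks, so one block spans an invariant
canonical subspace. -/
theorem eq_of_mem_stabilizerDirections (h₀ : Q₀ ∈ Matrix.specialOrthogonalGroup (Fin n) ℝ)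
    (hirr : CanonicallyIrreducible (Q₀ᵀ * Matrix.diagonal lam * Q₀)) {v : Fin n → ℝ}
    (hv : v ∈ stabilizerDirections Q₀) (i₀ i₁ : Fin n) : v i₀ = v i₁ := by
  obtain ⟨d, hd⟩ := exp_eq_of_mem_stabilizerDirections h₀ hv
  have hQ₀ := transpose_mul_self_of_mem h₀
  have hrow : ∀ i, ∃ j, Q₀ i j ≠ 0 := by
    intro i
    by_contra! h
    have := sum_row_sq hQ₀ i
    simp [h] at this
  by_contra hne
  refine hirr {j | d j = Real.exp (v i₀)} ?_ ?_ ?_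
  · obtain ⟨j, hj⟩ := hrow i₀
    exact ⟨j, (hd i₀ j hj).symm⟩
  · intro huniv
    obtain ⟨j, hj⟩ := hrow i₁
    have h1 : d j = Real.exp (v i₀) := by
      have : j ∈ {j | d j = Real.exp (v i₀)} := huniv ▸ Set.mem_univ j
      exact this
    rw [← hd i₁ j hj] at h1
    exact hne (Real.exp_injective h1).symm
  · intro w hw
    rw [mem_canonicalSubspace_iff] at hw ⊢
    intro a ha
    rw [Matrix.mulVec, dotProduct]
    refine Finset.sum_eq_zero fun b _ => ?_
    by_cases hb : d b = Real.exp (v i₀)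
    · refine mul_eq_zero_of_left ?_ _
      rw [Matrix.mul_apply]
      refine Finset.sum_eq_zero fun i _ => ?_
      rw [Matrix.mul_diagonal, Matrix.transpose_apply]
      by_cases h1 : Q₀ i a = 0
      · rw [h1, zero_mul, zero_mul]
      by_cases h2 : Q₀ i b = 0
      · rw [h2, mul_zero]
      exact absurd (show d a = Real.exp (v i₀) by rw [← hd i a h1, hd i b h2, hb]) ha
    · rw [hw b hb, mul_zero]

theorem sum_moment {Q : Matrix (Fin n) (Fin n) ℝ} (hQ : Qᵀ * Q = 1) :
    ∑ i, moment lam Q i = ∑ i, lam i := by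
  have hQ' : Qᵀᵀ * Qᵀ = 1 := by
    rw [Matrix.transpose_transpose]
    exact mul_eq_one_comm.1 hQ
  simp only [moment]
  rw [Finset.sum_comm]
  refine Finset.sum_congr rfl fun j _ => ?_
  rw [← Finset.mul_sum]
  have h1 := sum_row_sq hQ' j
  simp only [Matrix.transpose_apply] at h1
  rw [h1, mul_one]

theorem coe_momentSubspace_of_irreducible (h₀ : Q₀ ∈ Matrix.specialOrthogonalGroup (Fin n) ℝ)
    (hirr : CanonicallyIrreducible (Q₀ᵀ * Matrix.diagonal lam * Q₀)) :
    (momentSubspace lam Q₀ : Set (Fin n → ℝ)) = {x | ∑ i, x i = ∑ i, lam i} := by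
  have hsum := sum_moment (lam := lam) (transpose_mul_self_of_mem h₀)
  ext x
  constructor
  · intro hx
    have h1 := hx 1 fun k f g _ _ => by simp
    simpa [hsum] using h1
  · intro hx v hv
    have hx' : ∑ i, x i = ∑ i, lam i := hx
    rcases isEmpty_or_nonempty (Fin n) with he | ⟨⟨i₀⟩⟩
    · simp
    · have hc : ∀ i, v i = v i₀ := fun i => eq_of_mem_stabilizerDirections h₀ hirr hv i i₀
      simp only [hc, ← Finset.mul_sum, hx', hsum]

end Irreducible

end

/-! ### The theorem -/

theorem theorem2 (n : ℕ) (S : Matrix (Fin n) (Fin n) ℝ) (hS : S.IsSymm)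
    (lam : Fin n → ℝ) (hlam : StrictAnti lam) (hspec : spectrum ℝ S = Set.range lam) :
    closure (slice S) ⊆ isospectral lam ∧
    (∃ h : closure (slice S) ≃ₜ spectralPolytope lam S,
      ∀ T : closure (slice S), (h T : Fin n → ℝ) = bfr lam (T : Matrix (Fin n) (Fin n) ℝ)) ∧
    IsDiffeomorphismOn (bfr lam) (slice S) (intrinsicInterior ℝ (spectralPolytope lam S)) ∧
    (CanonicallyIrreducible S →
      (affineSpan ℝ (spectralPolytope lam S) : Set (Fin n → ℝ)) =
        {x | ∑ i, x i = ∑ i, lam i}) := by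
  obtain ⟨Q₀, h₀, hSQ⟩ := exists_special_orthogonal_diagonalization hS hlam hspec
  have hslice := slice_eq_image hlam h₀ hSQ
  have hclosure := closure_slice_eq_image hlam h₀ hSQ
  set V : Set (Matrix (Fin n) (Fin n) ℝ) :=
    {Q | Q ∈ closure (qrOrbit Q₀) ∧ (Qᵀ * Matrix.diagonal lam * Q).IsDiag} with hVdef
  have hV : V ⊆ closure (qrOrbit Q₀) := fun Q hQ => hQ.1
  have hV' : ∀ Q ∈ closure (qrOrbit Q₀), IsMonomial Q → Q ∈ V := fun Q hQ hm =>
    ⟨hQ, hm.isDiag lam⟩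
  have hbfr : ∀ Q ∈ closure (qrOrbit Q₀),
      bfr lam (Qᵀ * Matrix.diagonal lam * Q) = moment lam Q := fun Q hQ =>
    bfr_conj hlam (closure_qrOrbit_subset hQ)
  have hP : spectralPolytope lam S = convexHull ℝ (moment lam '' V) := by
    have h1 : bfr lam '' accessibleVertices S = moment lam '' V := by
      ext x
      constructor
      · rintro ⟨T, ⟨hT, hd⟩, rfl⟩
        rw [hclosure] at hT
        obtain ⟨Q, hQ, rfl⟩ := hT
        exact ⟨Q, ⟨hQ, hd⟩, (hbfr Q hQ).symm⟩
      · rintro ⟨Q, ⟨hQ, hd⟩, rfl⟩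
        exact ⟨_, ⟨hclosure ▸ ⟨Q, hQ, rfl⟩, hd⟩, hbfr Q hQ⟩
    rw [spectralPolytope, h1]
  have hinj : Set.InjOn (bfr lam) (closure (slice S)) := by
    rw [hclosure]
    rintro _ ⟨Q, hQ, rfl⟩ _ ⟨Q', hQ', rfl⟩ h
    simp only [hbfr Q hQ, hbfr Q' hQ'] at h
    rw [moment_injOn hlam hQ hQ' h]
  have himage : bfr lam '' closure (slice S) = spectralPolytope lam S := by
    rw [hP, ← image_moment_closure_eq hlam h₀ hV hV', hclosure, Set.image_image]
    exact Set.image_congr hbfr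
  have himage' : bfr lam '' slice S = intrinsicInterior ℝ (spectralPolytope lam S) := by
    rw [hP, ← image_moment_eq_intrinsicInterior hlam h₀ hV hV', hslice, Set.image_image]
    exact Set.image_congr fun Q hQ => hbfr Q (subset_closure hQ)
  have hpoly : Set.EqOn (bfr lam) (bfrPolynomial lam) (closure (slice S)) := by
    rw [hclosure]
    rintro _ ⟨Q, hQ, rfl⟩
    have hSO := closure_qrOrbit_subset hQ
    exact (bfr_conj hlam hSO).trans (bfrPolynomial_conj hlam hSO).symm
  refine ⟨?_, ?_, ⟨?_, ?_, ?_⟩, ?_⟩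
  · rw [hclosure]
    rintro _ ⟨Q, hQ, rfl⟩
    exact ⟨Q, closure_qrOrbit_subset hQ, rfl⟩
  · have hcompact : IsCompact (closure (slice S)) := by
      rw [hclosure]
      have hc : Continuous fun Q : Matrix (Fin n) (Fin n) ℝ => Qᵀ * Matrix.diagonal lam * Q :=
        (continuous_id.matrix_transpose.matrix_mul continuous_const).matrix_mul continuous_id
      exact isCompact_closure_qrOrbit.image hc
    have : CompactSpace (closure (slice S)) := isCompact_iff_compactSpace.1 hcompact
    have hbij : Set.BijOn (bfr lam) (closure (slice S)) (spectralPolytope lam S) :=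
      himage ▸ hinj.bijOn_image
    let e := hbij.equiv (bfr lam)
    have hcont : Continuous e := by
      have h1 : ContinuousOn (bfr lam) (closure (slice S)) :=
        (contDiff_bfrPolynomial lam).continuous.continuousOn.congr hpoly
      exact (continuousOn_iff_continuous_domRestrict.1 h1).subtype_mk _
    exact ⟨hcont.homeoOfEquivCompactToT2, fun T => rfl⟩
  · exact himage' ▸ (hinj.mono subset_closure).bijOn_image
  · exact fun T _ => ⟨Set.univ, isOpen_univ, Set.mem_univ T, bfrPolynomial lam,
      (contDiff_bfrPolynomial lam).contDiffOn,
      fun T hT => hpoly (subset_closure hT.1)⟩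
  · have hbij : Set.BijOn (bfr lam) (slice S) (intrinsicInterior ℝ (spectralPolytope lam S)) :=
      himage' ▸ (hinj.mono subset_closure).bijOn_image
    refine ⟨Function.invFunOn (bfr lam) (slice S), hbij.invOn_invFunOn, fun ξ₀ hξ₀ => ?_⟩
    obtain ⟨N, hN, hNO⟩ := exists_qrOrbit_param h₀
    rw [hP, ← image_moment_eq_intrinsicInterior hlam h₀ hV hV'] at hξ₀
    obtain ⟨Q, hQ, rfl⟩ := hξ₀
    obtain ⟨t, rfl⟩ := eq_param_of_mem_qrOrbit hNO hQ
    obtain ⟨U, hU, hmem, g, hg, hgU⟩ := exists_local_section hlam h₀ hN hNO t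
    -- By injectivity, the inverse agrees near `ξ₀` on the relative interior with this smooth map
    -- built from the local section.
    refine ⟨U, hU, hmem, fun ξ => (N (g ξ))ᵀ * Matrix.diagonal lam * N (g ξ), ?_, ?_⟩
    · have hNg : ∀ i j, ContDiffOn ℝ ∞ (fun ξ => N (g ξ) i j) U := fun i j =>
        (hN i j).comp_contDiffOn hg
      refine contDiffOn_pi.2 fun i => contDiffOn_pi.2 fun j => ?_
      have hentry : (fun ξ => ((N (g ξ))ᵀ * Matrix.diagonal lam * N (g ξ)) i j) =
          fun ξ => ∑ l, N (g ξ) l i * lam l * N (g ξ) l j := by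
        funext ξ
        rw [Matrix.mul_apply]
        exact Finset.sum_congr rfl fun l _ => by
          rw [Matrix.mul_diagonal, Matrix.transpose_apply]
      rw [hentry]
      exact ContDiffOn.sum fun l _ => ((hNg l i).mul contDiffOn_const).mul (hNg l j)
    · rintro ξ ⟨hξ, hξU⟩
      have hξH : ξ ∈ momentSubspace lam Q₀ := by
        rw [hP] at hξ
        exact affineSpan_convexHull_le hlam h₀ hV
          (subset_affineSpan ℝ _ (intrinsicInterior_subset hξ))
      have hNmem : N (g ξ) ∈ qrOrbit Q₀ := ⟨(hNO _).1, _, (hNO _).2⟩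
      have hTmem : (N (g ξ))ᵀ * Matrix.diagonal lam * N (g ξ) ∈ slice S :=
        hslice ▸ ⟨_, hNmem, rfl⟩
      have hval : bfr lam ((N (g ξ))ᵀ * Matrix.diagonal lam * N (g ξ)) = ξ :=
        (hbfr _ (subset_closure hNmem)).trans (hgU ξ hξU hξH)
      have h1 := hbij.invOn_invFunOn.1 hTmem
      rw [hval] at h1
      exact h1
  · intro hirr
    rw [hSQ] at hirr
    rw [hP, affineSpan_convexHull_eq hlam h₀ hV hV']
    exact coe_momentSubspace_of_irreducible h₀ hirr
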